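/- Let $k$ be a field, $R$ a unital commutative $k$-algebra, $B$ a $(k,R)$-Lie–Rinehart algebra (with $R$-linear anchor $B\to\operatorname{Der}_k(R)$, $b\mapsto (r\mapsto b(r))$) which is projective as an $R$-module, and $L$ a Lie algebra over $R$ with centre $Z(L)$. Let $\operatorname{Der}_{\mathcal D}(L)$ be the Lie–Rinehart algebra of pairs $(D,\sigma)$, where $\sigma\in\operatorname{Der}_k(R)$ and $D:L\to L$ is $k$-linear with $D(rl)=rD(l)+\sigma(r)l$ and $D[l,m]=[Dl,m]+[l,Dm]$ (bracket: commutator; anchor: $\sigma$), and let $\operatorname{Out}_{\mathcal D}(L)=\operatorname{Der}_{\mathcal D}(L)/\operatorname{ad}(L)$. Let $\bar\alpha:B\to\operatorname{Out}_{\mathcal D}(L)$ be a morphism of Lie–Rinehart algebras (so $(L,\bar\alpha)$ is a coupling of $B$); through $\bar\alpha$, $B$ acts on $Z(L)$. Denote by $\Omega^p_B(M)$ the alternating $R$-multilinear maps $B^p\to M$, by $$(d_\alpha\xi)(s_1,\dots,s_{p+1})=\sum_i(-1)^{i-1}\alpha(s_i)\,\xi(\dots,\hat s_i,\dots)+\sum_{i<j}(-1)^{i+j}\xi([s_i,s_j],\dots,\hat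 s_i,\dots,\hat s_j,\dots)$$ the differential of a connection $\alpha$, and by $H^p(B;Z(L))$ the cohomology of $\Omega_B^\bullet(Z(L))$. An extension of $B$ by $L$ is a short exact sequence $0\to L\to A\to B\to 0$ with $A$ a $(k,R)$-Lie–Rinehart algebra, $L\to A$ $R$-linear and bracket-preserving, and $A\to B$ a morphism of Lie–Rinehart algebras. It induces $\bar\alpha$ if for every $a\in A$ with image $b\in B$ the class $\bar\alpha(b)$ is represented by $[a,\cdot\,]|_L$. Two extensions are equivalent if there is a morphism of Lie–Rinehart algebras between them which is the identity on $L$ and on $B$. A lifting pair of $\bar\alpha$ is a pair $(\alpha,\rho)$ of an $R$-linear lift $\alpha:B\to\operatorname{Der}_{\mathcal D}(L)$ of $\bar\alpha$ and a form $\rho\in\Omega^2_B(L)$ with $[\alpha(b),\alpha(c)]-\alpha([b,c])=\operatorname{ad}_{\rho(b,c)}$ for all $b,c\in B$. An extension $A$ is described by $(\alpha,\rho)$ if it has an $R$-linear splitting $s:B\to A$ with $\alpha(b)=[s(b),\cdot\,]|_L$ and $\rho(b,c)=[s(b),s(c)]-s([b,c])$. **Theorem.** Lifting pairs of $\bar\alpha$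 exist, and there is a class $\mathbf{ob}(\bar\alpha)\in H^3(B;Z(L))$ with the following properties. 0. For every lifting pair $(\alpha,\rho)$ the form $d_\alpha\rho$ takes values in $Z(L)$, is closed, and represents $\mathbf{ob}(\bar\alpha)$. 1. $\mathbf{ob}(\bar\alpha)=0$ if and only if there exists an extension of $B$ by $L$ inducing $\bar\alpha$. 2. If $\mathbf{ob}(\bar\alpha)=0$, the set of equivalence classes of extensions of $B$ by $L$ inducing $\bar\alpha$ is a torsor over $H^2(B;Z(L))$, where the action is the following: every extension $A$ inducing $\bar\alpha$ is described by a lifting pair; and if $A$ is described by $(\alpha,\rho)$ and $\gamma\in\Omega^2_B(Z(L))$ is closed, then extensions inducing $\bar\alpha$ and described by $(\alpha,\rho+\gamma)$ exist, and each of them represents $[\gamma]\cdot[A]$. -/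

import Mathlib

/-!
Lie-Rinehart algebras over a commutative `k`-algebra `R`: Atiyah algebras, outer derivations,
couplings, Lie-Rinehart cohomology, lifting pairs and (nonabelian) extensions.

Lie-Rinehart algebras and their morphisms are those of Mathlib: `LieRinehartAlgebra k R B`, where
the anchor of `b : B` is `r ↦ ⁅b, r⁆`, and `LieRinehartAlgebra.Hom (AlgHom.id k R) B B'`
(`k`-linear and `R`-linear maps that respect the brackets and the anchors).
-/

namespace LRExt

set_option linter.unusedSectionVars false

universe uk uR uB uL uM

section Atiyah

variable (k : Type uk) (R : Type uR) (M : Type uM) [Field k] [CommRing R] [Algebra k R]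
  [AddCommGroup M] [Module R M] [Module k M] [IsScalarTower k R M]

/-- The `R`-module of derivative endomorphisms of `M`: pairs `(D, σ)` of a `k`-linear
endomorphism `D` of `M` and a derivation `σ` of `R` (the symbol of `D`) with
`D (r m) = r D m + σ(r) m`. -/
def atiyahSubmodule : Submodule R (Module.End k M × Derivation k R R) where
  carrier := {D | ∀ (r : R) (m : M), D.1 (r • m) = r • D.1 m + D.2 r • m}
  add_mem' {D E} hD hE r m := by
    simp only [Set.mem_ofPred_eq] at hD hE
    simp only [Prod.fst_add, Prod.snd_add, LinearMap.add_apply, Derivation.add_apply, hD, hE,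
      smul_add, add_smul]
    abel
  zero_mem' r m := by simp
  smul_mem' s D hD r m := by
    simp only [Set.mem_ofPred_eq] at hD
    simp only [Prod.smul_fst, Prod.smul_snd, LinearMap.smul_apply, Derivation.smul_apply, hD,
      smul_add, smul_eq_mul, mul_smul, smul_comm s r]

/-- The Atiyah algebra `𝒟_M` of the `R`-module `M`: first order differential operators on `M` with
scalar symbol, together with their symbols (which the operator determines if `M` is faithful). -/
abbrev Atiyah : Type (max uM uR) := atiyahSubmodule k R M

variable {k R M}

/-- The underlying `k`-linear operator of an element of the Atiyah algebra. -/
abbrev Atiyah.op (D : Atiyah k R M) : Module.End k M := D.1.1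

/-- The symbol of an element of the Atiyah algebra. -/
abbrev Atiyah.symbol (D : Atiyah k R M) : Derivation k R R := D.1.2

lemma Atiyah.op_smul (D : Atiyah k R M) (r : R) (m : M) :
    D.op (r • m) = r • D.op m + D.symbol r • m := D.2 r m

lemma Atiyah.ext' {D E : Atiyah k R M} (h : ∀ m, D.op m = E.op m)
    (h' : ∀ r, D.symbol r = E.symbol r) : D = E :=
  Subtype.ext (Prod.ext (LinearMap.ext h) (Derivation.ext h'))

/-- The bracket of the Atiyah algebra is the commutator of operators (and of symbols). -/
instance : Bracket (Atiyah k R M) (Atiyah k R M) where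
  bracket D E := ⟨(D.op * E.op - E.op * D.op, ⁅D.symbol, E.symbol⁆), fun r m => by
    simp only [LinearMap.sub_apply, Module.End.mul_apply, Atiyah.op_smul, map_add,
      Derivation.commutator_apply, smul_sub, sub_smul]
    abel⟩

@[simp] lemma Atiyah.lie_op (D E : Atiyah k R M) (m : M) :
    Atiyah.op ⁅D, E⁆ m = D.op (E.op m) - E.op (D.op m) := rfl

@[simp] lemma Atiyah.lie_symbol (D E : Atiyah k R M) :
    Atiyah.symbol ⁅D, E⁆ = ⁅D.symbol, E.symbol⁆ := rfl

@[simp] lemma Atiyah.add_op (D E : Atiyah k R M) : (D + E).op = D.op + E.op := rfl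
@[simp] lemma Atiyah.add_symbol (D E : Atiyah k R M) : (D + E).symbol = D.symbol + E.symbol := rfl
@[simp] lemma Atiyah.sub_op (D E : Atiyah k R M) : (D - E).op = D.op - E.op := rfl
@[simp] lemma Atiyah.sub_symbol (D E : Atiyah k R M) : (D - E).symbol = D.symbol - E.symbol := rfl
@[simp] lemma Atiyah.zero_op : (0 : Atiyah k R M).op = 0 := rfl
@[simp] lemma Atiyah.zero_symbol : (0 : Atiyah k R M).symbol = 0 := rfl
@[simp] lemma Atiyah.smul_op (r : R) (D : Atiyah k R M) : (r • D).op = r • D.op := rfl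
@[simp] lemma Atiyah.smul_symbol (r : R) (D : Atiyah k R M) :
    (r • D).symbol = r • D.symbol := rfl
@[simp] lemma Atiyah.smul_op' (c : k) (D : Atiyah k R M) : (c • D).op = c • D.op := rfl
@[simp] lemma Atiyah.smul_symbol' (c : k) (D : Atiyah k R M) :
    (c • D).symbol = c • D.symbol := rfl

instance : LieRing (Atiyah k R M) where
  add_lie D E F := Atiyah.ext' (fun m => by simp; abel) (fun r => by simp)
  lie_add D E F := Atiyah.ext' (fun m => by simp; abel) (fun r => by simp)
  lie_self D := Atiyah.ext' (fun m => by simp) (fun r => by simp)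
  leibniz_lie D E F := Atiyah.ext' (fun m => by simp; abel) (fun r => by
    simp only [Atiyah.lie_symbol, Atiyah.add_symbol]
    rw [leibniz_lie])

instance : LieAlgebra k (Atiyah k R M) where
  lie_smul c D E := Atiyah.ext' (fun m => by simp [smul_sub]) (fun r => by
    simp [Derivation.commutator_apply, smul_sub])

/-- The anchor of the Atiyah algebra is the symbol. -/
instance : LieRingModule (Atiyah k R M) R where
  bracket D r := D.symbol r
  add_lie D E r := rfl
  lie_add D r s := map_add _ _ _
  leibniz_lie D E r := by
    change D.symbol (E.symbol r) = ⁅D.symbol, E.symbol⁆ r + E.symbol (D.symbol r)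
    rw [Derivation.commutator_apply]; abel

@[simp] lemma Atiyah.lie_eq (D : Atiyah k R M) (r : R) : ⁅D, r⁆ = D.symbol r := rfl

instance : LieRinehartRing R (Atiyah k R M) where
  lie_smul_eq_mul' a b D := rfl
  leibniz_mul_right' D a b := by simp [mul_comm b]
  leibniz_smul_right' D E a := Atiyah.ext'
    (fun m => by simp [Atiyah.op_smul, smul_sub]; abel)
    (fun r => by simp [Derivation.commutator_apply])

instance : LieRinehartAlgebra k R (Atiyah k R M) where
  smul_lie c D r := rfl
  lie_smul c D r := by simp

end Atiyah

section Out

variable (k : Type uk) (R : Type uR) (L : Type uL) [Field k] [CommRing R] [Algebra k R]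
  [LieRing L] [LieAlgebra R L] [Module k L] [IsScalarTower k R L]

/-- `Der_𝒟(L)`: the elements of the Atiyah algebra of the `R`-Lie algebra `L` whose operator is a
derivation of the bracket of `L`. -/
def derD : LieRinehartSubalgebra R (Atiyah k R L) where
  carrier := {D | ∀ x y : L, D.op ⁅x, y⁆ = ⁅D.op x, y⁆ + ⁅x, D.op y⁆}
  add_mem' {D E} hD hE x y := by
    simp only [Set.mem_ofPred_eq] at hD hE
    simp [hD, hE]; abel
  zero_mem' x y := by simp
  smul_mem' r D hD x y := by
    simp only [Set.mem_ofPred_eq] at hD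
    simp [hD]
  lie_mem' {D E} hD hE x y := by
    simp only [Set.mem_ofPred_eq] at hD hE
    simp [hD, hE]; abel

variable {k R L}

/-- The underlying operator on `L` of an element of `Der_𝒟(L)`. -/
abbrev derOp (D : derD k R L) : Module.End k L := D.1.op

lemma derOp_lie (D : derD k R L) (x y : L) :
    derOp D ⁅x, y⁆ = ⁅derOp D x, y⁆ + ⁅x, derOp D y⁆ := D.2 x y

lemma derD_ext {D E : derD k R L} (h : ∀ m, derOp D m = derOp E m)
    (h' : ∀ r, D.1.symbol r = E.1.symbol r) : D = E := Subtype.ext (Atiyah.ext' h h')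

variable (k R L)

/-- The adjoint map `ad : L → Der_𝒟(L)`, `ad l = ⁅l, ·⁆` (with zero symbol). -/
def adD : L →ₗ[R] derD k R L where
  toFun l := ⟨⟨({ toFun := fun x => ⁅l, x⁆
                  map_add' := lie_add l
                  map_smul' := fun c x => by
                    simp only [RingHom.id_apply]
                    rw [← algebraMap_smul R c x, lie_smul, algebraMap_smul] }, 0),
      fun r m => by simp⟩, fun x y => leibniz_lie l x y⟩
  map_add' l m := derD_ext (fun x => add_lie l m x) (fun r => (add_zero _).symm)
  map_smul' r l := derD_ext (fun x => smul_lie r l x) (fun s => (smul_zero r).symm)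

variable {k R L}

@[simp] lemma adD_op (l x : L) : derOp (adD k R L l) x = ⁅l, x⁆ := rfl
@[simp] lemma adD_symbol (l : L) : (adD k R L l).1.symbol = 0 := rfl

/-- `ad L` is an ideal of `Der_𝒟(L)`. -/
lemma lie_adD (D : derD k R L) (l : L) : ⁅D, adD k R L l⁆ = adD k R L (derOp D l) :=
  derD_ext (fun x => by
    change derOp D ⁅l, x⁆ - ⁅l, derOp D x⁆ = ⁅derOp D l, x⁆
    rw [derOp_lie]; abel) (fun r => by
    change ⁅D.1.symbol, (0 : Derivation k R R)⁆ r = 0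
    simp)

variable (k R L)

/-- `Out_𝒟(L) = Der_𝒟(L) / ad L`. -/
abbrev OutD : Type (max uL uR) := derD k R L ⧸ LinearMap.range (adD k R L)

variable {k R L}

/-- The class in `Out_𝒟(L)` of an element of `Der_𝒟(L)`. -/
abbrev outMk (D : derD k R L) : OutD k R L := Submodule.Quotient.mk D

/-- The bracket of `Out_𝒟(L)`, induced by that of `Der_𝒟(L)`. -/
instance : Bracket (OutD k R L) (OutD k R L) where
  bracket := Quotient.map₂ (fun D E => ⁅D, E⁆) (by
    intro D D' hD E E' hE
    rw [← Quotient.eq_iff_equiv] at hD hE ⊢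
    change Submodule.Quotient.mk D = Submodule.Quotient.mk D' at hD
    change Submodule.Quotient.mk E = Submodule.Quotient.mk E' at hE
    change Submodule.Quotient.mk ⁅D, E⁆ = Submodule.Quotient.mk ⁅D', E'⁆
    rw [Submodule.Quotient.eq] at hD hE ⊢
    obtain ⟨l, hl⟩ := hD
    obtain ⟨m, hm⟩ := hE
    refine ⟨derOp D' m - derOp E l, ?_⟩
    rw [map_sub, ← lie_adD, ← lie_adD, hl, hm, lie_sub, lie_sub, ← lie_skew D E,
      ← lie_skew D' E]
    abel)

@[simp] lemma outMk_lie (D E : derD k R L) : ⁅outMk D, outMk E⁆ = outMk ⁅D, E⁆ := rfl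

instance : LieRing (OutD k R L) where
  add_lie := by
    rintro ⟨D⟩ ⟨E⟩ ⟨F⟩
    exact congrArg outMk (add_lie D E F)
  lie_add := by
    rintro ⟨D⟩ ⟨E⟩ ⟨F⟩
    exact congrArg outMk (lie_add D E F)
  lie_self := by
    rintro ⟨D⟩
    exact congrArg outMk (lie_self D)
  leibniz_lie := by
    rintro ⟨D⟩ ⟨E⟩ ⟨F⟩
    exact congrArg outMk (leibniz_lie D E F)

instance : LieAlgebra k (OutD k R L) where
  lie_smul := by
    rintro c ⟨D⟩ ⟨E⟩
    exact congrArg outMk (lie_smul c D E)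

variable (k R L)

/-- The symbol map on `Out_𝒟(L)`; it is well defined since the elements of `ad L` have zero
symbol. -/
def outSymbol : OutD k R L →ₗ[R] Derivation k R R :=
  Submodule.liftQ _
    { toFun := fun D : derD k R L => D.1.symbol
      map_add' := fun _ _ => rfl
      map_smul' := fun _ _ => rfl }
    (by rintro _ ⟨l, rfl⟩; rfl)

variable {k R L}

@[simp] lemma outSymbol_mk (D : derD k R L) : outSymbol k R L (outMk D) = D.1.symbol := rfl

/-- The anchor of `Out_𝒟(L)` is the symbol. -/
instance : LieRingModule (OutD k R L) R where
  bracket D r := outSymbol k R L D r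
  add_lie D E r := by
    change outSymbol k R L (D + E) r = _
    rw [map_add]; rfl
  lie_add D r s := map_add _ _ _
  leibniz_lie := by
    rintro ⟨D⟩ ⟨E⟩ r
    exact leibniz_lie D.1 E.1 r

@[simp] lemma outMk_anchor (D : derD k R L) (r : R) : ⁅outMk D, r⁆ = D.1.symbol r := rfl

instance : LieRinehartRing R (OutD k R L) where
  lie_smul_eq_mul' := by
    rintro a b ⟨D⟩
    rfl
  leibniz_mul_right' := by
    rintro ⟨D⟩ a b
    exact LieRinehartRing.leibniz_mul_right D.1 a b
  leibniz_smul_right' := by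
    rintro ⟨D⟩ ⟨E⟩ a
    exact congrArg outMk (LieRinehartRing.leibniz_smul_right D E a)

instance : LieRinehartAlgebra k R (OutD k R L) where
  smul_lie := by
    rintro c ⟨D⟩ r
    rfl
  lie_smul := by
    rintro c ⟨D⟩ r
    exact (D.1.symbol).map_smul c r

variable (R L) in
/-- The centre `Z(L)` of `L`. -/
abbrev Z : Type uL := LieAlgebra.center R L

lemma derOp_mem_center (D : derD k R L) (z : Z R L) :
    derOp D (z : L) ∈ LieAlgebra.center R L := by
  rw [LieModule.mem_maxTrivSubmodule]
  intro x
  have hz := (LieModule.mem_maxTrivSubmodule (R := R) (L := L) (M := L) (z : L)).1 z.2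
  have h := derOp_lie D x (z : L)
  rw [hz, hz, map_zero, zero_add] at h
  exact h.symm

/-- Restriction of an element of `Der_𝒟(L)` to the centre of `L`. -/
def restrictCenter : derD k R L →ₗ[R] Atiyah k R (Z R L) where
  toFun D := ⟨({ toFun := fun z => ⟨derOp D z, derOp_mem_center D z⟩
                 map_add' := fun z w => Subtype.ext (map_add (derOp D) (z : L) (w : L))
                 map_smul' := fun c z => Subtype.ext (map_smul (derOp D) c (z : L)) },
      D.1.symbol), fun r z => Subtype.ext (D.1.op_smul r (z : L))⟩
  map_add' _ _ := rfl
  map_smul' _ _ := rfl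

variable (k R L)

/-- The action of `Out_𝒟(L)` on the centre of `L`, a morphism of Lie-Rinehart algebras
`Out_𝒟(L) → 𝒟_{Z(L)}`; it is well defined since `ad L` acts trivially on the centre. -/
def outCenter : LieRinehartAlgebra.Hom (AlgHom.id k R) (OutD k R L) (Atiyah k R (Z R L)) where
  toFun := Submodule.liftQ (LinearMap.range (adD k R L)) restrictCenter (by
    rintro _ ⟨l, rfl⟩
    refine Atiyah.ext' (fun z => Subtype.ext ?_) (fun r => rfl)
    exact (LieModule.mem_maxTrivSubmodule (R := R) (L := L) (M := L) (z : L)).1 z.2 l)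
  map_add' := map_add _
  map_smul' := by
    rintro c ⟨D⟩
    rfl
  map_lie' := by
    rintro ⟨D⟩ ⟨E⟩
    rfl
  map_smul_apply' := by
    rintro r ⟨D⟩
    rfl
  apply_lie' := by
    rintro r ⟨D⟩
    rfl

variable {k R L}

@[simp] lemma outCenter_mk (D : derD k R L) (z : Z R L) :
    (((outCenter k R L (outMk D)).op z : Z R L) : L) = derOp D z := rfl

end Out

section Cohomology

variable {k : Type uk} {R : Type uR} {B : Type uB} {M : Type uM} [Field k] [CommRing R]
  [Algebra k R] [LieRing B] [Module R B] [LieRingModule B R] [LieAlgebra k B]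
  [AddCommGroup M] [Module R M] [Module k M] [IsScalarTower k R M]

/-- The differential `d_∇ ξ` of a `p`-form `ξ` on `B` with values in a module `M` with
a connection `∇ : B → 𝒟_M`, as a function of its `p + 1` arguments:
`∑ᵢ (-1)ⁱ ∇(sᵢ)(ξ(…, ŝᵢ, …)) + ∑_{i<j} (-1)^{i+j} ξ(⁅sᵢ, sⱼ⁆, …, ŝᵢ, …, ŝⱼ, …)`, the indices
running from `0` to `p`. For `i < j` the arguments other than `sᵢ, sⱼ` are listed by
`s ∘ j.succAbove ∘ i.succAbove`. In degree `0` the second sum is empty. -/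
def lrDiff (nabla : B →ₗ[R] Atiyah k R M) :
    (p : ℕ) → (B [⋀^Fin p]→ₗ[R] M) → (Fin (p + 1) → B) → M
  | 0, ξ, s => (nabla (s 0)).op (ξ (fun i => i.elim0))
  | q + 1, ξ, s =>
      (∑ i : Fin (q + 2), (-1 : ℤ) ^ (i : ℕ) • (nabla (s i)).op (ξ (fun m => s (i.succAbove m))))
      + ∑ j : Fin (q + 2), ∑ i : Fin (q + 1),
          if i.castSucc < j then
            (-1 : ℤ) ^ ((i : ℕ) + (j : ℕ)) •
              ξ (Fin.cons ⁅s i.castSucc, s j⁆ (fun m => s (j.succAbove (i.succAbove m))))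
          else 0

lemma lrDiff_add (nabla : B →ₗ[R] Atiyah k R M) (p : ℕ) (ξ η : B [⋀^Fin p]→ₗ[R] M)
    (s : Fin (p + 1) → B) :
    lrDiff nabla p (ξ + η) s = lrDiff nabla p ξ s + lrDiff nabla p η s := by
  cases p with
  | zero => simp [lrDiff]
  | succ q =>
    simp only [lrDiff, AlternatingMap.add_apply, map_add, smul_add, Finset.sum_add_distrib]
    have : ∀ (c : Prop) [Decidable c] (x y : M),
        (if c then x + y else 0) = (if c then x else 0) + (if c then y else 0) := by
      intro c _ x y; split_ifs <;> simp
    simp only [this, Finset.sum_add_distrib]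
    abel

/-- The differential as an additive map. -/
def lrDiffHom (nabla : B →ₗ[R] Atiyah k R M) (p : ℕ) :
    (B [⋀^Fin p]→ₗ[R] M) →+ ((Fin (p + 1) → B) → M) :=
  AddMonoidHom.mk' (lrDiff nabla p) (fun ξ η => funext (lrDiff_add nabla p ξ η))

/-- Closed `p`-forms with values in the representation `V` of `B`. -/
def cocycles (V : LieRinehartAlgebra.Hom (AlgHom.id k R) B (Atiyah k R M)) (p : ℕ) :
    AddSubgroup (B [⋀^Fin p]→ₗ[R] M) :=
  (lrDiffHom V.toLinearMap' p).ker

/-- Exact `p`-forms with values in the representation `V` of `B`. -/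
def coboundaries (V : LieRinehartAlgebra.Hom (AlgHom.id k R) B (Atiyah k R M)) :
    (p : ℕ) → AddSubgroup (B [⋀^Fin p]→ₗ[R] M)
  | 0 => ⊥
  | p + 1 => (lrDiffHom V.toLinearMap' p).range.comap
      (AddMonoidHom.mk' (fun ξ : B [⋀^Fin (p + 1)]→ₗ[R] M => (ξ : (Fin (p + 1) → B) → M))
        (fun _ _ => rfl))

/-- The Lie-Rinehart cohomology `Hᵖ(B; V)`: closed `p`-forms modulo exact `p`-forms, for the complex
of alternating `R`-multilinear forms on `B` with values in the representation `V`. (The quotient is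
by the exact forms that are closed; these are all exact forms, as `V` is flat.) -/
abbrev H (V : LieRinehartAlgebra.Hom (AlgHom.id k R) B (Atiyah k R M)) (p : ℕ) : Type _ :=
  cocycles V p ⧸ (coboundaries V p).addSubgroupOf (cocycles V p)

/-- The cohomology class of a closed form. -/
abbrev H.mk {V : LieRinehartAlgebra.Hom (AlgHom.id k R) B (Atiyah k R M)} {p : ℕ}
    (c : cocycles V p) : H V p :=
  QuotientAddGroup.mk c

end Cohomology

section Extensions

variable {k : Type uk} {R : Type uR} {B : Type uB} {L : Type uL} [Field k] [CommRing R]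
  [Algebra k R] [LieRing B] [Module R B] [LieRingModule B R] [LieAlgebra k B]
  [LieRing L] [LieAlgebra R L] [Module k L] [IsScalarTower k R L]

/-- The representation of `B` on the centre of `L` defined by a coupling. -/
def centerRep (αbar : LieRinehartAlgebra.Hom (AlgHom.id k R) B (OutD k R L)) :
    LieRinehartAlgebra.Hom (AlgHom.id k R) B (Atiyah k R (Z R L)) :=
  αbar.comp (outCenter k R L)

/-- A lifting pair `(α, ρ)` of a coupling `αbar`: an `R`-linear lift `α : B → Der_𝒟(L)` of `αbar` and
an `L`-valued `2`-form `ρ` on `B` with `F_α = ad_ρ`, where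
`F_α(b, c) = ⁅α b, α c⁆ - α ⁅b, c⁆` is the curvature. -/
structure LiftingPair (αbar : LieRinehartAlgebra.Hom (AlgHom.id k R) B (OutD k R L)) where
  α : B →ₗ[R] derD k R L
  ρ : B [⋀^Fin 2]→ₗ[R] L
  lift : ∀ b, outMk (α b) = αbar b
  curvature : ∀ b c, ⁅α b, α c⁆ - α ⁅b, c⁆ = adD k R L (ρ ![b, c])

/-- The connection on the `R`-module `L` underlying a lifting pair. -/
def LiftingPair.conn {αbar : LieRinehartAlgebra.Hom (AlgHom.id k R) B (OutD k R L)}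
    (P : LiftingPair αbar) : B →ₗ[R] Atiyah k R L :=
  (derD k R L).toSubmodule.subtype ∘ₗ P.α

variable (R L) in
/-- The inclusion of the centre. -/
def Z.incl : Z R L →ₗ[R] L := (LieAlgebra.center R L).toSubmodule.subtype

/-- The lifting pair `(α, ρ + γ)`, where `γ` is a form with values in the centre of `L`. -/
def LiftingPair.addCentral {αbar : LieRinehartAlgebra.Hom (AlgHom.id k R) B (OutD k R L)}
    (P : LiftingPair αbar) (γ : B [⋀^Fin 2]→ₗ[R] Z R L) : LiftingPair αbar where
  α := P.α
  ρ := P.ρ + (Z.incl R L).compAlternatingMap γ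
  lift := P.lift
  curvature b c := by
    rw [P.curvature, AlternatingMap.add_apply, map_add]
    have : adD k R L ((Z.incl R L).compAlternatingMap γ ![b, c]) = 0 :=
      derD_ext (fun x => by
        have hz := (LieModule.mem_maxTrivSubmodule (R := R) (L := L) (M := L) _).1
          (γ ![b, c]).2 x
        change ⁅((γ ![b, c] : Z R L) : L), x⁆ = 0
        rw [← lie_skew, hz, neg_zero]) (fun r => rfl)
    rw [this, add_zero]

variable (k R B L) in
/-- An extension `0 → L → A → B → 0` of the Lie-Rinehart algebra `B` by the `R`-Lie algebra `L`:
a Lie-Rinehart algebra `A`, an injective `R`-linear map `L → A` that respects the brackets, and a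
surjective morphism of Lie-Rinehart algebras `A → B` whose kernel is the image of `L`. As
`A ≅ B × L` when `B` is projective, one universe level suffices. -/
structure Extension where
  A : Type (max uB uL)
  [lieRing : LieRing A]
  [module : Module R A]
  [lieRingModule : LieRingModule A R]
  [lieRinehartRing : LieRinehartRing R A]
  [lieAlgebra : LieAlgebra k A]
  [lieRinehartAlgebra : LieRinehartAlgebra k R A]
  incl : L →ₗ[R] A
  incl_lie : ∀ l m : L, incl ⁅l, m⁆ = ⁅incl l, incl m⁆
  proj : LieRinehartAlgebra.Hom (AlgHom.id k R) A B
  incl_injective : Function.Injective incl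
  proj_surjective : Function.Surjective proj
  exact : ∀ a : A, proj a = 0 ↔ ∃ l, incl l = a

attribute [instance] Extension.lieRing Extension.module Extension.lieRingModule
  Extension.lieRinehartRing Extension.lieAlgebra Extension.lieRinehartAlgebra

namespace Extension

/-- The extension `E` induces the coupling `αbar`: for every `a : A`, the class `αbar (proj a)` is
represented by the operator `⁅a, ·⁆` on `L`. -/
def Induces (E : Extension k R B L)
    (αbar : LieRinehartAlgebra.Hom (AlgHom.id k R) B (OutD k R L)) : Prop :=
  ∀ a : E.A, ∃ D : derD k R L, outMk D = αbar (E.proj a) ∧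
    ∀ l : L, E.incl (derOp D l) = ⁅a, E.incl l⁆

/-- Equivalence of extensions: a morphism of Lie-Rinehart algebras `A → A'` that is compatible with
the inclusions of `L` and the projections to `B`. -/
def Equivalent (E E' : Extension k R B L) : Prop :=
  ∃ f : LieRinehartAlgebra.Hom (AlgHom.id k R) E.A E'.A,
    (∀ l, f (E.incl l) = E'.incl l) ∧ ∀ a, E'.proj (f a) = E.proj a

lemma Equivalent.refl (E : Extension k R B L) : E.Equivalent E :=
  ⟨LieRinehartAlgebra.Hom.id, fun _ => rfl, fun _ => rfl⟩

lemma Equivalent.trans {E E' E'' : Extension k R B L} (h : E.Equivalent E')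
    (h' : E'.Equivalent E'') : E.Equivalent E'' := by
  obtain ⟨f, hf, hf'⟩ := h
  obtain ⟨g, hg, hg'⟩ := h'
  refine ⟨f.comp g, fun l => ?_, fun a => ?_⟩
  · change g (f (E.incl l)) = _
    rw [hf, hg]
  · change E''.proj (g (f a)) = _
    rw [hg', hf']

lemma Equivalent.symm {E E' : Extension k R B L} (h : E.Equivalent E') :
    E'.Equivalent E := by
  obtain ⟨f, hf, hf'⟩ := h
  have hinj : Function.Injective f.toLieHom := by
    rw [injective_iff_map_eq_zero]
    intro a ha
    have h0 : E.proj a = 0 := by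
      rw [← hf' a, ha]
      exact map_zero E'.proj.toLieHom
    obtain ⟨l, rfl⟩ := (E.exact a).1 h0
    have : E'.incl l = 0 := by rw [← hf l]; exact ha
    rw [(map_eq_zero_iff _ E'.incl_injective).1 this, map_zero]
  have hsurj : Function.Surjective f.toLieHom := by
    intro a'
    obtain ⟨a, ha⟩ := E.proj_surjective (E'.proj a')
    have h0 : E'.proj (a' - f a) = 0 := by
      have : E'.proj (a' - f a) = E'.proj a' - E'.proj (f a) := map_sub E'.proj.toLieHom _ _
      rw [this, hf', ha, sub_self]
    obtain ⟨l, hl⟩ := (E'.exact _).1 h0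
    refine ⟨a + E.incl l, ?_⟩
    rw [map_add]
    have := hf l
    rw [this, hl]
    abel
  let e := LieEquiv.ofBijective f.toLieHom ⟨hinj, hsurj⟩
  have he : ∀ a', f.toLieHom (e.symm a') = a' := fun a' => e.apply_symm_apply a'
  refine ⟨{ toLieHom := e.symm.toLieHom, map_smul_apply' := ?_, apply_lie' := ?_ }, ?_, ?_⟩
  · intro r a'
    apply hinj
    have := f.map_smul_apply r (e.symm a')
    refine (he _).trans ?_
    refine Eq.trans ?_ this.symm
    rw [he]
    rfl
  · intro r a'
    have := f.apply_lie r (e.symm a')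
    rw [he] at this
    exact this.symm
  · intro l
    apply hinj
    exact (he _).trans (hf l).symm
  · intro a'
    have := hf' (e.symm a')
    rw [he] at this
    exact this.symm

/-- The extension `E` is described by the lifting pair `P`: for some `R`-linear splitting
`s : B → A`, one has `α b = ⁅s b, ·⁆` on `L` and `ρ (b, c) = ⁅s b, s c⁆ - s ⁅b, c⁆`. -/
def HasLiftingPair {αbar : LieRinehartAlgebra.Hom (AlgHom.id k R) B (OutD k R L)}
    (E : Extension k R B L) (P : LiftingPair αbar) : Prop :=
  ∃ s : B →ₗ[R] E.A, (∀ b, E.proj (s b) = b) ∧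
    (∀ b l, E.incl (derOp (P.α b) l) = ⁅s b, E.incl l⁆) ∧
    ∀ b c, E.incl (P.ρ ![b, c]) = ⁅s b, s c⁆ - s ⁅b, c⁆

end Extension

/-- Extensions of `B` by `L` that induce the given coupling. -/
abbrev ExtensionOver (αbar : LieRinehartAlgebra.Hom (AlgHom.id k R) B (OutD k R L)) : Type _ :=
  {E : Extension k R B L // E.Induces αbar}

/-- Equivalence of extensions, as a setoid. -/
instance extSetoid (αbar : LieRinehartAlgebra.Hom (AlgHom.id k R) B (OutD k R L)) :
    Setoid (ExtensionOver αbar) where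
  r E E' := E.1.Equivalent E'.1
  iseqv := ⟨fun E => .refl E.1, fun h => h.symm, fun h h' => h.trans h'⟩

/-- The set of equivalence classes of extensions of `B` by `L` inducing the given coupling. -/
abbrev ExtClasses (αbar : LieRinehartAlgebra.Hom (AlgHom.id k R) B (OutD k R L)) : Type _ :=
  Quotient (extSetoid αbar)

/-- The equivalence class of an extension. -/
abbrev ExtClasses.mk {αbar : LieRinehartAlgebra.Hom (AlgHom.id k R) B (OutD k R L)}
    (E : ExtensionOver αbar) : ExtClasses αbar :=
  Quotient.mk (extSetoid αbar) E

end Extensions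

end LRExt

open LRExt

/-! An extension together with an `R`-linear splitting `s` amounts to a lifting pair with `d_α ρ =
0`: the pair records the brackets of `s(b)` with `L` and with `s(c)`, and `d_α ρ = 0` is the Jacobi
identity on `s(B)` (`Describes.obstruction_eq_zero`). Conversely, such a pair defines a bracket on
`B × L` (`twistedExtension`), and extensions with a common pair are equivalent
(`Describes.equivalent`). The theorem thus becomes a statement about lifting pairs.

Pairs are changed in two ways: `gauge` by a linear map `f : B → L` (a change of splitting), and
`addCentral` by a central two-form `γ`. Projectivity of `B` and of its exterior powers gives the
existence of pairs, and any two pairs of one coupling differ by a gauge followed by a central change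
(`exists_eq_gauge_addCentral`).

By the Bianchi identity `d_α ρ` is central (`lrDiff_mem_center`). It is closed because `d_α² ρ` is a
sum of brackets of values of `ρ` that cancel in pairs (`obstruction_mem_cocycles`). A gauge leaves
this form unchanged (`obstruction_gauge`) and `γ` adds `dγ` to it (`obstruction_addCentral`). Its
class therefore depends only on the coupling, and the class vanishes exactly when some pair has `d_α
ρ = 0`.

The pairs of one extension form a single gauge orbit, so equivalence classes of extensions are gauge
orbits of pairs with `d_α ρ = 0`. Closed central forms act on these orbits, transitively by the
comparison of pairs. A central change is a gauge exactly when `γ` is exact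
(`exact_of_addCentral_eq_gauge`, `addCentral_eq_gauge_of_exact`), so the induced action of `H²` is
well defined and free. -/

namespace LRExt

set_option linter.unusedSectionVars false

/-! ### Alternating forms of degree two and three -/

section Forms

variable {R B M : Type*} [CommRing R] [AddCommGroup B] [Module R B] [AddCommGroup M] [Module R M]

/-- An alternating form of degree two from a function of two arguments. -/
def twoForm (f : B → B → M) (hadd : ∀ a a' b, f (a + a') b = f a b + f a' b)
    (hsmul : ∀ (r : R) a b, f (r • a) b = r • f a b) (hswap : ∀ a b, f a b = -f b a)
    (hself : ∀ a, f a a = 0) : B [⋀^Fin 2]→ₗ[R] M where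
  toFun s := f (s 0) (s 1)
  map_update_add' s i x y := by
    have hadd' : ∀ a b b', f a (b + b') = f a b + f a b' := fun a b b' => by
      rw [hswap, hadd, hswap b, hswap b']; abel
    match i with
    | 0 => simp [hadd]
    | 1 => simp [hadd']
  map_update_smul' s i r x := by
    have hsmul' : ∀ a b, f a (r • b) = r • f a b := fun a b => by
      rw [hswap, hsmul, hswap b, smul_neg, neg_neg]
    match i with
    | 0 => simp [hsmul]
    | 1 => simp [hsmul']
  map_eq_zero_of_eq' s i j h hij := by
    match i, j with
    | 0, 0 => exact absurd rfl hij
    | 1, 1 => exact absurd rfl hij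
    | 0, 1 => rw [← h, hself]
    | 1, 0 => rw [h, hself]

/-- An alternating form of degree three from a function of three arguments. -/
def threeForm (f : B → B → B → M) (hadd : ∀ a a' b c, f (a + a') b c = f a b c + f a' b c)
    (hsmul : ∀ (r : R) a b c, f (r • a) b c = r • f a b c)
    (hswap : ∀ a b c, f a b c = -f b a c) (hswap' : ∀ a b c, f a b c = -f a c b)
    (hself : ∀ a b, f a a b = 0) : B [⋀^Fin 3]→ₗ[R] M where
  toFun s := f (s 0) (s 1) (s 2)
  map_update_add' s i x y := by
    have h1 : ∀ a b b' c, f a (b + b') c = f a b c + f a b' c := fun a b b' c => by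
      rw [hswap, hadd, hswap b, hswap b']; abel
    have h2 : ∀ a b c c', f a b (c + c') = f a b c + f a b c' := fun a b c c' => by
      rw [hswap', h1, hswap' a c, hswap' a c']; abel
    have e01 : (0 : Fin 3) ≠ 1 := by omega
    have e02 : (0 : Fin 3) ≠ 2 := by omega
    have e12 : (1 : Fin 3) ≠ 2 := by omega
    match i with
    | 0 => simp only [Function.update_self, Function.update_of_ne e01.symm,
        Function.update_of_ne e02.symm, hadd]
    | 1 => simp only [Function.update_self, Function.update_of_ne e01,
        Function.update_of_ne e12.symm, h1]
    | 2 => simp only [Function.update_self, Function.update_of_ne e02,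
        Function.update_of_ne e12, h2]
  map_update_smul' s i r x := by
    have h1 : ∀ a b c, f a (r • b) c = r • f a b c := fun a b c => by
      rw [hswap, hsmul, hswap b, smul_neg, neg_neg]
    have h2 : ∀ a b c, f a b (r • c) = r • f a b c := fun a b c => by
      rw [hswap', h1, hswap' a c, smul_neg, neg_neg]
    have e01 : (0 : Fin 3) ≠ 1 := by omega
    have e02 : (0 : Fin 3) ≠ 2 := by omega
    have e12 : (1 : Fin 3) ≠ 2 := by omega
    match i with
    | 0 => simp only [Function.update_self, Function.update_of_ne e01.symm,
        Function.update_of_ne e02.symm, hsmul]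
    | 1 => simp only [Function.update_self, Function.update_of_ne e01,
        Function.update_of_ne e12.symm, h1]
    | 2 => simp only [Function.update_self, Function.update_of_ne e02,
        Function.update_of_ne e12, h2]
  map_eq_zero_of_eq' s i j h hij := by
    have h' : ∀ a b, f a b b = 0 := fun a b => by rw [hswap, hswap', hself, neg_zero, neg_zero]
    have h'' : ∀ a b, f a b a = 0 := fun a b => by rw [hswap', hself, neg_zero]
    match i, j with
    | 0, 0 => exact absurd rfl hij
    | 1, 1 => exact absurd rfl hij
    | 2, 2 => exact absurd rfl hij
    | 0, 1 => rw [← h, hself]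
    | 1, 0 => rw [h, hself]
    | 0, 2 => rw [← h, h'']
    | 2, 0 => rw [h, h'']
    | 1, 2 => rw [← h, h']
    | 2, 1 => rw [h, h']

@[simp] lemma twoForm_apply (f : B → B → M) (hadd hsmul hswap hself) (s : Fin 2 → B) :
    twoForm (R := R) f hadd hsmul hswap hself s = f (s 0) (s 1) := rfl

@[simp] lemma threeForm_apply (f : B → B → B → M) (hadd hsmul hswap hswap' hself)
    (s : Fin 3 → B) :
    threeForm (R := R) f hadd hsmul hswap hswap' hself s = f (s 0) (s 1) (s 2) := rfl

variable (ξ : B [⋀^Fin 2]→ₗ[R] M)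

lemma form_add_left (a a' b : B) : ξ ![a + a', b] = ξ ![a, b] + ξ ![a', b] :=
  ξ.map_vecCons_add ![b] a a'

lemma form_smul_left (r : R) (a b : B) : ξ ![r • a, b] = r • ξ ![a, b] :=
  ξ.map_vecCons_smul ![b] r a

lemma form_swap (a b : B) : ξ ![a, b] = -ξ ![b, a] := by
  have := ξ.map_swap ![b, a] (i := 0) (j := 1) (by decide)
  rw [← this]
  congr 1
  ext i
  fin_cases i <;> simp

lemma form_self (a : B) : ξ ![a, a] = 0 :=
  ξ.map_eq_zero_of_eq _ (i := 0) (j := 1) rfl (by decide)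

lemma form_add_right (a b b' : B) : ξ ![a, b + b'] = ξ ![a, b] + ξ ![a, b'] := by
  rw [form_swap, form_add_left, form_swap ξ a, form_swap ξ a b']; abel

lemma form_smul_right (r : R) (a b : B) : ξ ![a, r • b] = r • ξ ![a, b] := by
  rw [form_swap, form_smul_left, form_swap ξ a, smul_neg]

lemma form_zero_left (b : B) : ξ ![0, b] = 0 := by
  simpa using form_smul_left ξ 0 0 b

lemma form_neg_left (a b : B) : ξ ![-a, b] = -ξ ![a, b] := by
  simpa using form_smul_left ξ (-1) a b

lemma form_sub_left (a a' b : B) : ξ ![a - a', b] = ξ ![a, b] - ξ ![a', b] := by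
  rw [sub_eq_add_neg, form_add_left, form_neg_left, sub_eq_add_neg]

end Forms

/-! ### The differential in degrees one to three -/

section Differential

variable {k R B M : Type*} [Field k] [CommRing R]
  [Algebra k R] [LieRing B] [Module R B] [LieRingModule B R] [LieAlgebra k B]
  [AddCommGroup M] [Module R M] [Module k M] [IsScalarTower k R M]
  (nabla : B →ₗ[R] Atiyah k R M)

lemma eq_vec_one {X : Type*} (s : Fin 1 → X) : s = ![s 0] := by
  ext i; fin_cases i; rfl
lemma eq_vec_two {X : Type*} (s : Fin 2 → X) : s = ![s 0, s 1] := by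
  ext i; fin_cases i <;> rfl
lemma eq_vec_three {X : Type*} (s : Fin 3 → X) : s = ![s 0, s 1, s 2] := by
  ext i; fin_cases i <;> rfl

lemma lrDiff_one (ξ : B [⋀^Fin 1]→ₗ[R] M) (s : Fin 2 → B) :
    lrDiff nabla 1 ξ s = (nabla (s 0)).op (ξ ![s 1]) - (nabla (s 1)).op (ξ ![s 0])
      - ξ ![⁅s 0, s 1⁆] := by
  -- Rewriting `ξ` as a function of separate entries lets the reindexed tuples in the sums be
  -- evaluated entry by entry, with no equality of tuples to prove.
  obtain ⟨g, h⟩ : ∃ g : B → M, ∀ f, ξ f = g (f 0) :=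
    ⟨fun a => ξ ![a], fun f => congrArg ξ (eq_vec_one f)⟩
  simp only [lrDiff, h]
  simp +decide [-Int.reduceNeg]
  abel

lemma lrDiff_two (ξ : B [⋀^Fin 2]→ₗ[R] M) (s : Fin 3 → B) :
    lrDiff nabla 2 ξ s = (nabla (s 0)).op (ξ ![s 1, s 2]) - (nabla (s 1)).op (ξ ![s 0, s 2])
      + (nabla (s 2)).op (ξ ![s 0, s 1]) - ξ ![⁅s 0, s 1⁆, s 2] + ξ ![⁅s 0, s 2⁆, s 1]
      - ξ ![⁅s 1, s 2⁆, s 0] := by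
  obtain ⟨g, h⟩ : ∃ g : B → B → M, ∀ f, ξ f = g (f 0) (f 1) :=
    ⟨fun a b => ξ ![a, b], fun f => congrArg ξ (eq_vec_two f)⟩
  change (∑ i : Fin 3, (-1 : ℤ) ^ (i : ℕ) •
      (nabla (s i)).op (ξ (fun m : Fin 2 => s (i.succAbove m))))
    + ∑ j : Fin 3, ∑ i : Fin 2, (if i.castSucc < j then (-1 : ℤ) ^ ((i : ℕ) + (j : ℕ)) •
      ξ (Fin.cons ⁅s i.castSucc, s j⁆ (fun m : Fin 1 => s (j.succAbove (i.succAbove m)))) else 0)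
    = _
  simp only [Fin.sum_univ_two, Fin.sum_univ_three, h]
  simp +decide [Fin.succAbove]
  abel

lemma lrDiff_three (ξ : B [⋀^Fin 3]→ₗ[R] M) (s : Fin 4 → B) :
    lrDiff nabla 3 ξ s = (nabla (s 0)).op (ξ ![s 1, s 2, s 3])
      - (nabla (s 1)).op (ξ ![s 0, s 2, s 3])
      + (nabla (s 2)).op (ξ ![s 0, s 1, s 3]) - (nabla (s 3)).op (ξ ![s 0, s 1, s 2])
      - ξ ![⁅s 0, s 1⁆, s 2, s 3] + ξ ![⁅s 0, s 2⁆, s 1, s 3] - ξ ![⁅s 0, s 3⁆, s 1, s 2]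
      - ξ ![⁅s 1, s 2⁆, s 0, s 3] + ξ ![⁅s 1, s 3⁆, s 0, s 2] - ξ ![⁅s 2, s 3⁆, s 0, s 1] := by
  obtain ⟨g, h⟩ : ∃ g : B → B → B → M, ∀ f, ξ f = g (f 0) (f 1) (f 2) :=
    ⟨fun a b c => ξ ![a, b, c], fun f => congrArg ξ (eq_vec_three f)⟩
  change (∑ i : Fin 4, (-1 : ℤ) ^ (i : ℕ) •
      (nabla (s i)).op (ξ (fun m : Fin 3 => s (i.succAbove m))))
    + ∑ j : Fin 4, ∑ i : Fin 3, (if i.castSucc < j then (-1 : ℤ) ^ ((i : ℕ) + (j : ℕ)) •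
      ξ (Fin.cons ⁅s i.castSucc, s j⁆ (fun m : Fin 2 => s (j.succAbove (i.succAbove m)))) else 0)
    = _
  simp only [Fin.sum_univ_four, Fin.sum_univ_three, h]
  have hc : ∀ (a : B) (t : Fin 2 → B), (Fin.cons a t : Fin 3 → B) 2 = t 1 := fun _ _ => rfl
  simp +decide [Fin.succAbove, hc]
  abel

end Differential

/-! ### Lifting linear and alternating maps from a projective module -/

section Projective

variable {R B M N : Type*} [CommRing R] [AddCommGroup B] [Module R B] [Module.Projective R B]
  [AddCommGroup M] [Module R M] [AddCommGroup N] [Module R N]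

lemma exists_linear_lift (f : M →ₗ[R] N) (g : B →ₗ[R] N) (h : ∀ b, g b ∈ LinearMap.range f) :
    ∃ l : B →ₗ[R] M, ∀ b, f (l b) = g b := by
  obtain ⟨l, hl⟩ := Module.projective_lifting_property f.rangeRestrict (g.codRestrict _ h)
    f.surjective_rangeRestrict
  exact ⟨l, fun b => congrArg Subtype.val (LinearMap.congr_fun hl b)⟩

/-- A projective module is a retract of a free one, and the functor `⋀ⁿ` preserves retracts. -/
instance projective_exteriorPower (n : ℕ) : Module.Projective R (⋀[R]^n B) := by
  obtain ⟨s, hs⟩ := (Module.projective_def' (R := R) (P := B)).1 inferInstance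
  refine Module.Projective.of_split (M := ⋀[R]^n (B →₀ R)) (exteriorPower.map n s)
    (exteriorPower.map n (Finsupp.linearCombination R id)) ?_
  rw [← exteriorPower.map_comp, hs, exteriorPower.map_id]

/-- Alternating maps are linear maps on `⋀ⁿ B`, which is projective. This produces the two-form `ρ`
from a curvature known only to take values in the image of `L`. -/
lemma exists_alternating_lift {n : ℕ} (f : M →ₗ[R] N) (g : B [⋀^Fin n]→ₗ[R] N)
    (h : ∀ b, g b ∈ LinearMap.range f) :
    ∃ l : B [⋀^Fin n]→ₗ[R] M, ∀ b, f (l b) = g b := by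
  obtain ⟨l, hl⟩ := exists_linear_lift f.rangeRestrict
    (exteriorPower.alternatingMapLinearEquiv (g.codRestrict _ h))
    (fun b => by simp [LinearMap.range_eq_top.2 f.surjective_rangeRestrict])
  refine ⟨exteriorPower.alternatingMapLinearEquiv.symm l, fun b => ?_⟩
  have := hl (exteriorPower.ιMulti R n b)
  rw [exteriorPower.alternatingMapLinearEquiv_apply_ιMulti] at this
  simpa using congrArg Subtype.val this

end Projective

/-! ### Existence of lifting pairs -/

section Lifting

variable {k R B L : Type*} [Field k] [CommRing R]
  [Algebra k R] [LieRing B] [Module R B] [LieRingModule B R] [LieAlgebra k B]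
  [LieRing L] [LieAlgebra R L] [Module k L] [IsScalarTower k R L]

/-- A coupling respects anchors and `ad L` has zero symbol, so all lifts of `αbar b` share one
symbol. This makes the operators of a lift differentiate scalars exactly as `B` does. -/
lemma symbol_of_lift (αbar : LieRinehartAlgebra.Hom (AlgHom.id k R) B (OutD k R L))
    {D : derD k R L} {b : B} (h : outMk D = αbar b) (r : R) : D.1.symbol r = ⁅b, r⁆ := by
  have := αbar.apply_lie r b
  rw [← h] at this
  exact this.symm

variable [LieRinehartRing R B]

/-- The curvature of an `R`-linear lift of a coupling, as a two-form. -/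
def curvatureForm {αbar : LieRinehartAlgebra.Hom (AlgHom.id k R) B (OutD k R L)}
    (α : B →ₗ[R] derD k R L) (h : ∀ b, outMk (α b) = αbar b) : B [⋀^Fin 2]→ₗ[R] derD k R L :=
  twoForm (fun b c => ⁅α b, α c⁆ - α ⁅b, c⁆)
    (fun a a' b => by simp only [map_add, add_lie]; abel)
    (fun r a b => by
      have h1 : ⁅r • a, b⁆ = r • ⁅a, b⁆ - ⁅b, r⁆ • a := by
        rw [← lie_skew, LieRinehartRing.leibniz_smul_right, ← lie_skew a b, smul_neg]; abel
      have h2 : ⁅r • α a, α b⁆ = r • ⁅α a, α b⁆ - ⁅b, r⁆ • α a := by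
        rw [← lie_skew, LieRinehartRing.leibniz_smul_right, ← lie_skew (α a), smul_neg,
          ← symbol_of_lift αbar (h b)]
        change -(_ + (α b).1.symbol r • α a) = _
        abel
      rw [h1, map_smul, h2, map_sub, map_smul, map_smul, smul_sub]; abel)
    (fun a b => by rw [← lie_skew, ← lie_skew b a, map_neg]; abel)
    (fun a => by simp)

/-- Since `αbar` respects brackets, the curvature of any linear lift `α` vanishes in `Out_𝒟(L)`,
hence is `ad`-valued and lifts to a form `ρ`. -/
theorem exists_liftingPair [Module.Projective R B]
    (αbar : LieRinehartAlgebra.Hom (AlgHom.id k R) B (OutD k R L)) :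
    Nonempty (LiftingPair αbar) := by
  obtain ⟨α, hα⟩ := exists_linear_lift (LinearMap.range (adD k R L)).mkQ αbar.toLinearMap'
    (fun b => by rw [Submodule.range_mkQ]; trivial)
  have hα' : ∀ b, outMk (α b) = αbar b := hα
  obtain ⟨ρ, hρ⟩ := exists_alternating_lift (adD k R L) (curvatureForm α hα') (fun b => by
    have : outMk (curvatureForm α hα' b) = 0 := by
      change ⁅outMk (α (b 0)), outMk (α (b 1))⁆ - outMk (α ⁅b 0, b 1⁆) = 0
      rw [hα', hα', hα']
      exact sub_eq_zero.2 (αbar.toLieHom.map_lie _ _).symm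
    exact (Submodule.Quotient.mk_eq_zero _).1 this)
  exact ⟨⟨α, ρ, hα', fun b c => (hρ ![b, c]).symm⟩⟩

end Lifting

/-! ### Differentials of one- and two-forms as alternating forms -/

section DifferentialForms

variable {k R B M : Type*} [Field k] [CommRing R]
  [Algebra k R] [LieRing B] [Module R B] [LieRingModule B R] [LieRinehartRing R B]
  [LieAlgebra k B]
  [AddCommGroup M] [Module R M] [Module k M] [IsScalarTower k R M]

lemma smul_lie_left (r : R) (a b : B) : ⁅r • a, b⁆ = r • ⁅a, b⁆ - ⁅b, r⁆ • a := by
  rw [← lie_skew, LieRinehartRing.leibniz_smul_right, ← lie_skew a b, smul_neg]; abel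

/-- The differential of a one-form with respect to a connection. -/
def diffOne (nabla : B →ₗ[R] Atiyah k R M) (h : ∀ b r, (nabla b).symbol r = ⁅b, r⁆)
    (f : B →ₗ[R] M) : B [⋀^Fin 2]→ₗ[R] M :=
  twoForm (fun a b => (nabla a).op (f b) - (nabla b).op (f a) - f ⁅a, b⁆)
    (fun a a' b => by
      simp only [map_add, add_lie, Atiyah.add_op, LinearMap.add_apply]; abel)
    (fun r a b => by
      -- The symbol term from `∇ b` cancels the anchor term from `⁅r • a, b⁆`; this is where `h` is
      -- needed.
      simp only [map_smul, smul_lie_left, Atiyah.smul_op, LinearMap.smul_apply, Atiyah.op_smul, h,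
        map_sub, smul_sub]
      abel)
    (fun a b => by rw [← lie_skew b a, map_neg]; abel)
    (fun a => by simp)

/-- The differential of a two-form with respect to a connection. -/
def diffTwo (nabla : B →ₗ[R] Atiyah k R M) (h : ∀ b r, (nabla b).symbol r = ⁅b, r⁆)
    (ξ : B [⋀^Fin 2]→ₗ[R] M) : B [⋀^Fin 3]→ₗ[R] M :=
  threeForm (fun a b c => (nabla a).op (ξ ![b, c]) - (nabla b).op (ξ ![a, c])
      + (nabla c).op (ξ ![a, b]) - ξ ![⁅a, b⁆, c] + ξ ![⁅a, c⁆, b] - ξ ![⁅b, c⁆, a])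
    (fun a a' b c => by
      simp only [map_add, add_lie, Atiyah.add_op, LinearMap.add_apply, form_add_left,
        form_add_right]
      abel)
    (fun r a b c => by
      simp only [map_smul, smul_lie_left, Atiyah.smul_op, LinearMap.smul_apply, Atiyah.op_smul, h,
        form_sub_left, form_smul_left, form_smul_right, smul_sub, smul_add]
      abel)
    (fun a b c => by
      rw [form_swap ξ b a, ← lie_skew b a, form_neg_left, map_neg]; abel)
    (fun a b c => by
      rw [form_swap ξ c b, ← lie_skew c b, form_neg_left, map_neg]; abel)
    (fun a b => by simp [form_self, form_zero_left])

lemma diffTwo_apply (nabla : B →ₗ[R] Atiyah k R M) (h : ∀ b r, (nabla b).symbol r = ⁅b, r⁆)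
    (ξ : B [⋀^Fin 2]→ₗ[R] M) (s : Fin 3 → B) : diffTwo nabla h ξ s = lrDiff nabla 2 ξ s :=
  (lrDiff_two nabla ξ s).symm

end DifferentialForms

/-! ### The obstruction form of a lifting pair: centrality and closedness -/

section Pairs

variable {k R B L : Type*} [Field k] [CommRing R]
  [Algebra k R] [LieRing B] [Module R B] [LieRingModule B R] [LieAlgebra k B]
  [LieRing L] [LieAlgebra R L] [Module k L] [IsScalarTower k R L]
  {αbar : LieRinehartAlgebra.Hom (AlgHom.id k R) B (OutD k R L)}

/-- A representation as an `R`-linear connection. -/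
def repConn {M : Type*} [AddCommGroup M] [Module R M] [Module k M] [IsScalarTower k R M]
    (V : LieRinehartAlgebra.Hom (AlgHom.id k R) B (Atiyah k R M)) : B →ₗ[R] Atiyah k R M :=
  V.toLinearMap'

lemma mem_cocycles_iff {M : Type*} [AddCommGroup M] [Module R M] [Module k M]
    [IsScalarTower k R M] {V : LieRinehartAlgebra.Hom (AlgHom.id k R) B (Atiyah k R M)}
    {p : ℕ} {ξ : B [⋀^Fin p]→ₗ[R] M} :
    ξ ∈ cocycles V p ↔ ∀ s, lrDiff (repConn V) p ξ s = 0 :=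
  funext_iff

lemma mem_coboundaries_iff {M : Type*} [AddCommGroup M] [Module R M] [Module k M]
    [IsScalarTower k R M] {V : LieRinehartAlgebra.Hom (AlgHom.id k R) B (Atiyah k R M)}
    {p : ℕ} {ξ : B [⋀^Fin (p + 1)]→ₗ[R] M} :
    ξ ∈ coboundaries V (p + 1) ↔ ∃ η, ∀ s, lrDiff (repConn V) p η s = ξ s :=
  exists_congr fun _ => funext_iff

/-- Inner derivations kill the centre, so any lift computes the action of `B` on it; identities in
`Z(L)` can then be checked in `L`. -/
lemma centerRep_op {D : derD k R L} {b : B} (h : outMk D = αbar b) (z : Z R L) :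
    (((repConn (centerRep αbar) b).op z : Z R L) : L) = derOp D (z : L) := by
  rw [← outCenter_mk, h]
  rfl

lemma center_lie (z : Z R L) (l : L) : ⁅(z : L), l⁆ = 0 := by
  rw [← lie_skew, (LieModule.mem_maxTrivSubmodule (R := R) (L := L) (M := L) _).1 z.2 l, neg_zero]

lemma mem_center_of_lie {x : L} (h : ∀ l : L, ⁅x, l⁆ = 0) : x ∈ LieAlgebra.center R L :=
  (LieModule.mem_maxTrivSubmodule (R := R) (L := L) (M := L) x).2 fun l => by
    rw [← lie_skew, h, neg_zero]

lemma Z.coe_sub (z w : Z R L) : ((z - w : Z R L) : L) = z - w := rfl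
lemma Z.coe_add (z w : Z R L) : ((z + w : Z R L) : L) = z + w := rfl
lemma Z.coe_zero : ((0 : Z R L) : L) = 0 := rfl

namespace LiftingPair

/-- The operator on `L` of an element of `B`, for a lifting pair. -/
abbrev act (P : LiftingPair αbar) (b : B) : Module.End k L := derOp (P.α b)

lemma act_add (P : LiftingPair αbar) (b c : B) (l : L) :
    P.act (b + c) l = P.act b l + P.act c l := by
  change derOp (P.α (b + c)) l = _
  rw [map_add]; rfl

lemma act_smul (P : LiftingPair αbar) (r : R) (b : B) (l : L) :
    P.act (r • b) l = r • P.act b l := by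
  change derOp (P.α (r • b)) l = _
  rw [map_smul]; rfl

lemma act_neg (P : LiftingPair αbar) (b : B) (l : L) : P.act (-b) l = -P.act b l := by
  simpa using P.act_smul (-1) b l

lemma act_sub (P : LiftingPair αbar) (b c : B) (l : L) :
    P.act (b - c) l = P.act b l - P.act c l := by
  rw [sub_eq_add_neg, act_add, act_neg, sub_eq_add_neg]

lemma act_apply_smul (P : LiftingPair αbar) (b : B) (r : R) (l : L) :
    P.act b (r • l) = r • P.act b l + ⁅b, r⁆ • l := by
  rw [← symbol_of_lift αbar (P.lift b)]
  exact (P.α b).1.op_smul r l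

lemma act_lie (P : LiftingPair αbar) (b : B) (l m : L) :
    P.act b ⁅l, m⁆ = ⁅P.act b l, m⁆ + ⁅l, P.act b m⁆ := derOp_lie _ l m

/-- The curvature equation as a rule for commuting two operators, used to bring iterated actions
into a fixed order. -/
lemma act_act (P : LiftingPair αbar) (b c : B) (l : L) :
    P.act b (P.act c l) = P.act c (P.act b l) + P.act ⁅b, c⁆ l + ⁅P.ρ ![b, c], l⁆ := by
  have : P.act b (P.act c l) - P.act c (P.act b l) - P.act ⁅b, c⁆ l = ⁅P.ρ ![b, c], l⁆ :=
    congrArg (fun D : derD k R L => derOp D l) (P.curvature b c)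
  rw [← this]; abel

lemma conn_symbol (P : LiftingPair αbar) (b : B) (r : R) : (P.conn b).symbol r = ⁅b, r⁆ :=
  symbol_of_lift αbar (P.lift b) r

lemma lrDiff_apply (P : LiftingPair αbar) (s : Fin 3 → B) :
    lrDiff P.conn 2 P.ρ s =
      P.act (s 0) (P.ρ ![s 1, s 2]) - P.act (s 1) (P.ρ ![s 0, s 2])
      + P.act (s 2) (P.ρ ![s 0, s 1]) - P.ρ ![⁅s 0, s 1⁆, s 2] + P.ρ ![⁅s 0, s 2⁆, s 1]
      - P.ρ ![⁅s 1, s 2⁆, s 0] := lrDiff_two _ _ _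

lemma lie_lie_swap (a b c : B) : ⁅⁅a, b⁆, c⁆ = ⁅⁅a, c⁆, b⁆ - ⁅⁅b, c⁆, a⁆ := by
  rw [lie_lie a b c, ← lie_skew a ⁅b, c⁆, ← lie_skew ⁅a, c⁆ b]; abel

/-- Bianchi identity: `ad` of `d_α ρ` is the covariant differential of the curvature. Once `ad_ρ` is
replaced by commutators of operators, everything cancels up to the Jacobi identity in `B`. -/
lemma lrDiff_mem_center (P : LiftingPair αbar) (s : Fin 3 → B) :
    lrDiff P.conn 2 P.ρ s ∈ LieAlgebra.center R L := by
  refine mem_center_of_lie fun l => ?_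
  have h1 : ∀ a b c, ⁅P.act a (P.ρ ![b, c]), l⁆
      = P.act a ⁅P.ρ ![b, c], l⁆ - ⁅P.ρ ![b, c], P.act a l⁆ := fun a b c => by
    rw [act_lie]; abel
  have h2 : ∀ b c l, ⁅P.ρ ![b, c], l⁆ =
      P.act b (P.act c l) - P.act c (P.act b l) - P.act ⁅b, c⁆ l := fun b c l => by
    rw [P.act_act b c]; abel
  rw [lrDiff_apply]
  generalize s 0 = a
  generalize s 1 = b
  generalize s 2 = c
  simp only [add_lie, sub_lie, h1, h2, map_sub]
  rw [lie_lie_swap a b c, act_sub]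
  abel

variable [LieRinehartRing R B]

/-- The form `d_α ρ` of a lifting pair, with values in the centre. -/
def obstruction (P : LiftingPair αbar) : B [⋀^Fin 3]→ₗ[R] Z R L :=
  (diffTwo P.conn P.conn_symbol P.ρ).codRestrict (LieAlgebra.center R L).toSubmodule
    fun s => by rw [diffTwo_apply]; exact P.lrDiff_mem_center s

lemma coe_obstruction (P : LiftingPair αbar) (s : Fin 3 → B) :
    ((P.obstruction s : Z R L) : L) = lrDiff P.conn 2 P.ρ s := diffTwo_apply _ _ _ s

lemma obstruction_mem_cocycles (P : LiftingPair αbar) :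
    P.obstruction ∈ cocycles (centerRep αbar) 3 := by
  rw [mem_cocycles_iff]
  intro s
  apply Subtype.ext
  rw [lrDiff_three]
  simp only [Z.coe_sub, Z.coe_add, Z.coe_zero]
  have hc : ∀ b (z : Z R L), (((repConn (centerRep αbar) b).op z : Z R L) : L)
    = P.act b (z : L) := fun b z => centerRep_op (P.lift b) z
  have hr : ∀ a b c, ((P.obstruction ![a, b, c] : Z R L) : L) = P.act a (P.ρ ![b, c])
      - P.act b (P.ρ ![a, c])
      + P.act c (P.ρ ![a, b]) - P.ρ ![⁅a, b⁆, c] + P.ρ ![⁅a, c⁆, b]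
      - P.ρ ![⁅b, c⁆, a] := fun a b c => by
    rw [coe_obstruction, lrDiff_apply]; rfl
  have hsw := form_swap P.ρ
  have hsub := form_sub_left P.ρ
  have haa := P.act_act
  generalize s 0 = a
  generalize s 1 = b
  generalize s 2 = c
  generalize s 3 = d
  simp only [hc, hr, map_sub, map_add]
  -- Commuting the operators leaves the six brackets `⁅ρ(·,·), ρ(·,·)⁆` over the splittings of the
  -- four arguments into two pairs; complementary pairs cancel by antisymmetry. The other terms
  -- cancel by the Jacobi identity in `B`.
  rw [haa a b, haa a c, haa a d, haa b c, haa b d, haa c d,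
    lie_lie_swap a b c, lie_lie_swap a b d, lie_lie_swap a c d, lie_lie_swap b c d,
    hsub, hsub, hsub, hsub, hsw ⁅c, d⁆ ⁅a, b⁆, hsw ⁅b, d⁆ ⁅a, c⁆, hsw ⁅b, c⁆ ⁅a, d⁆,
    ← lie_skew (P.ρ ![a, b]), ← lie_skew (P.ρ ![a, c]), ← lie_skew (P.ρ ![a, d])]
  abel

end LiftingPair

end Pairs

/-! ### Gauge transformations and central changes of lifting pairs -/

section Gauge

variable {k R B L : Type*} [Field k] [CommRing R]
  [Algebra k R] [LieRing B] [Module R B] [LieRingModule B R] [LieAlgebra k B]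
  [LieRing L] [LieAlgebra R L] [Module k L] [IsScalarTower k R L]
  {αbar : LieRinehartAlgebra.Hom (AlgHom.id k R) B (OutD k R L)}

namespace LiftingPair

lemma ext' {P P' : LiftingPair αbar} (h : ∀ b l, P.act b l = P'.act b l)
    (h' : ∀ b c, P.ρ ![b, c] = P'.ρ ![b, c]) : P = P' := by
  have hα : P.α = P'.α := LinearMap.ext fun b => derD_ext (h b) fun r => by
    rw [symbol_of_lift αbar (P.lift b), symbol_of_lift αbar (P'.lift b)]
  have hρ : P.ρ = P'.ρ := AlternatingMap.ext fun s => by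
    rw [eq_vec_two s, h']
  cases P; cases P'
  subst hα hρ
  rfl

/-- The two-form `(b, c) ↦ ⁅f b, f c⁆`. -/
def lieForm (f : B →ₗ[R] L) : B [⋀^Fin 2]→ₗ[R] L :=
  twoForm (fun b c => ⁅f b, f c⁆) (fun a a' b => by simp) (fun r a b => by simp)
    (fun a b => (lie_skew _ _).symm) (fun a => lie_self _)

lemma addCentral_ρ (P : LiftingPair αbar) (γ : B [⋀^Fin 2]→ₗ[R] Z R L) (s : Fin 2 → B) :
    (P.addCentral γ).ρ s = P.ρ s + (γ s : L) := rfl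

lemma addCentral_act (P : LiftingPair αbar) (γ : B [⋀^Fin 2]→ₗ[R] Z R L) (b : B) (l : L) :
    (P.addCentral γ).act b l = P.act b l := rfl

/-- Equal operators have equal curvature, so the two forms `ρ` have the same adjoint action and
their difference is central. -/
lemma eq_addCentral {P P' : LiftingPair αbar} (h : ∀ b l, P'.act b l = P.act b l) :
    ∃ γ, P' = P.addCentral γ := by
  have hc : ∀ s, (P'.ρ - P.ρ) s ∈ (LieAlgebra.center R L).toSubmodule := fun s => by
    refine mem_center_of_lie fun l => ?_
    rw [eq_vec_two s, AlternatingMap.sub_apply, sub_lie]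
    have h1 := P.act_act (s 0) (s 1) l
    have h2 := P'.act_act (s 0) (s 1) l
    simp only [h] at h2
    rw [h1] at h2
    rw [sub_eq_zero]
    exact (add_left_cancel h2).symm
  refine ⟨(P'.ρ - P.ρ).codRestrict _ hc, ext' h fun b c => ?_⟩
  rw [addCentral_ρ]
  change _ = _ + (P'.ρ ![b, c] - P.ρ ![b, c])
  abel

variable [LieRinehartRing R B]

/-- The lifting pair obtained from `P` by adding `ad ∘ f` to the lift. -/
def gauge (P : LiftingPair αbar) (f : B →ₗ[R] L) : LiftingPair αbar where
  α := P.α + adD k R L ∘ₗ f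
  ρ := P.ρ + diffOne P.conn P.conn_symbol f + lieForm f
  lift b := by
    rw [← P.lift b]
    refine (Submodule.Quotient.eq _).2 ⟨f b, ?_⟩
    simp
  curvature b c := by
    -- The operator part is the Maurer–Cartan formula: replacing `α` by `α + ad f` adds `ad` of `d_α
    -- f + ⁅f, f⁆` to the curvature.
    refine derD_ext (fun l => ?_) (fun r => ?_)
    · change (P.act b (P.act c l + ⁅f c, l⁆) + ⁅f b, P.act c l + ⁅f c, l⁆⁆)
        - (P.act c (P.act b l + ⁅f b, l⁆) + ⁅f c, P.act b l + ⁅f b, l⁆⁆)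
        - (P.act ⁅b, c⁆ l + ⁅f ⁅b, c⁆, l⁆)
        = ⁅P.ρ ![b, c] + (P.act b (f c) - P.act c (f b) - f ⁅b, c⁆) + ⁅f b, f c⁆, l⁆
      simp only [map_add, lie_add, add_lie, sub_lie, P.act_lie, lie_lie]
      rw [P.act_act b c]
      abel
    · have := congrArg (fun D : derD k R L => D.1.symbol r) (P.curvature b c)
      change (⁅(P.α b).1.symbol + 0, (P.α c).1.symbol + 0⁆ - ((P.α ⁅b, c⁆).1.symbol + 0)) r = 0
      simp only [add_zero]
      exact this

lemma gauge_act (P : LiftingPair αbar) (f : B →ₗ[R] L) (b : B) (l : L) :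
    (P.gauge f).act b l = P.act b l + ⁅f b, l⁆ := rfl

lemma gauge_ρ (P : LiftingPair αbar) (f : B →ₗ[R] L) (b c : B) :
    (P.gauge f).ρ ![b, c] =
      P.ρ ![b, c] + (P.act b (f c) - P.act c (f b) - f ⁅b, c⁆) + ⁅f b, f c⁆ := rfl

lemma gauge_addCentral (P : LiftingPair αbar) (f : B →ₗ[R] L) (γ : B [⋀^Fin 2]→ₗ[R] Z R L) :
    (P.gauge f).addCentral γ = (P.addCentral γ).gauge f :=
  ext' (fun _ _ => rfl) fun b c => by
    simp only [gauge_ρ, addCentral_ρ, addCentral_act]; abel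

/-- The form itself is invariant, not only its class. The contribution of `d_α² f`, which is the
curvature acting on `f`, cancels the new brackets of `f` with `ρ`; the terms quadratic in `f` cancel
each other, and the cubic ones vanish by the Jacobi identity in `L`. -/
lemma obstruction_gauge (P : LiftingPair αbar) (f : B →ₗ[R] L) :
    (P.gauge f).obstruction = P.obstruction := by
  refine AlternatingMap.ext fun s => Subtype.ext ?_
  rw [coe_obstruction, coe_obstruction, lrDiff_apply, lrDiff_apply]
  generalize s 0 = a
  generalize s 1 = b
  generalize s 2 = c
  simp only [gauge_act, gauge_ρ, map_add, map_sub, P.act_lie]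
  rw [P.act_act a b, P.act_act a c, P.act_act b c, lie_lie_swap a b c, map_sub,
    ← lie_skew (f c) (f ⁅a, b⁆), ← lie_skew (f b) (f ⁅a, c⁆), ← lie_skew (f a) (f ⁅b, c⁆),
    ← lie_skew (f c) (P.ρ ![a, b]), ← lie_skew (f b) (P.ρ ![a, c]),
    ← lie_skew (f a) (P.ρ ![b, c]),
    leibniz_lie (f a) (f b) (f c), ← lie_skew (f c) ⁅f a, f b⁆,
    ← lie_skew (f c) (P.act a (f b)), ← lie_skew (f c) (P.act b (f a)),
    ← lie_skew (f b) (P.act c (f a))]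
  abel

lemma obstruction_addCentral (P : LiftingPair αbar) (γ : B [⋀^Fin 2]→ₗ[R] Z R L)
    (s : Fin 3 → B) : (P.addCentral γ).obstruction s =
      P.obstruction s + lrDiff (repConn (centerRep αbar)) 2 γ s := by
  apply Subtype.ext
  have hc : ∀ b (z : Z R L), (((repConn (centerRep αbar) b).op z : Z R L) : L)
    = P.act b (z : L) := fun b z => centerRep_op (P.lift b) z
  rw [lrDiff_two]
  simp only [Z.coe_add, Z.coe_sub, hc]
  rw [coe_obstruction, coe_obstruction, lrDiff_apply, lrDiff_apply]
  simp only [addCentral_ρ, addCentral_act, map_add]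
  abel

/-- Two lifts of one coupling differ by an `ad L`-valued map, which projectivity lifts to `f : B →
L`. After this gauge the operators agree and only a central form is left. -/
lemma exists_eq_gauge_addCentral [Module.Projective R B] (P P' : LiftingPair αbar) :
    ∃ f γ, P' = (P.gauge f).addCentral γ := by
  obtain ⟨f, hf⟩ := exists_linear_lift (adD k R L) (P'.α - P.α) (fun b => by
    have : outMk (P'.α b) = outMk (P.α b) := by rw [P.lift, P'.lift]
    exact (Submodule.Quotient.eq _).1 this)
  refine ⟨f, eq_addCentral fun b l => ?_⟩
  have := congrArg (fun D : derD k R L => derOp D l) (hf b)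
  change ⁅f b, l⁆ = P'.act b l - P.act b l at this
  rw [gauge_act, this]
  abel

/-- Central changes preserve the operators, so `ad ∘ f = 0` and `f` is central. Comparing the two
forms then reads `γ = df`. -/
lemma exact_of_addCentral_eq_gauge {P : LiftingPair αbar} {f : B →ₗ[R] L}
    {γ : B [⋀^Fin 2]→ₗ[R] Z R L} (h : P.addCentral γ = P.gauge f) :
    γ ∈ coboundaries (centerRep αbar) 2 := by
  have hact : ∀ b (l : L), ⁅f b, l⁆ = 0 := fun b l => by
    have := gauge_act P f b l
    rw [← h, addCentral_act] at this
    exact left_eq_add.1 this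
  let g : B →ₗ[R] Z R L := f.codRestrict (LieAlgebra.center R L).toSubmodule
    fun b => mem_center_of_lie (hact b)
  rw [mem_coboundaries_iff]
  refine ⟨AlternatingMap.ofSubsingleton R B (Z R L) 0 g, fun s => Subtype.ext ?_⟩
  have hc : ∀ b (z : Z R L), (((repConn (centerRep αbar) b).op z : Z R L) : L)
    = P.act b (z : L) := fun b z => centerRep_op (P.lift b) z
  rw [lrDiff_one]
  simp only [Z.coe_sub, hc]
  have h2 : (P.addCentral γ).ρ ![s 0, s 1] = (P.gauge f).ρ ![s 0, s 1] := by rw [h]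
  rw [addCentral_ρ, gauge_ρ, hact, add_zero, ← eq_vec_two, add_right_inj] at h2
  exact h2.symm

lemma addCentral_eq_gauge_of_exact (P : LiftingPair αbar) {γ : B [⋀^Fin 2]→ₗ[R] Z R L}
    (h : γ ∈ coboundaries (centerRep αbar) 2) : ∃ f, P.addCentral γ = P.gauge f := by
  obtain ⟨η, hη⟩ := mem_coboundaries_iff.1 h
  let g : B →ₗ[R] Z R L := (AlternatingMap.ofSubsingleton R B (Z R L) 0).symm η
  have hg : ∀ b, η ![b] = g b := fun b => by
    change η _ = η _
    congr 1
    ext i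
    fin_cases i
    rfl
  have hc : ∀ b (z : Z R L), (((repConn (centerRep αbar) b).op z : Z R L) : L)
    = P.act b (z : L) := fun b z => centerRep_op (P.lift b) z
  refine ⟨Z.incl R L ∘ₗ g, ext' (fun b l => ?_) fun b c => ?_⟩
  · rw [addCentral_act, gauge_act]
    change _ = _ + ⁅(g b : L), l⁆
    rw [center_lie, add_zero]
  · rw [addCentral_ρ, gauge_ρ, ← hη, lrDiff_one]
    simp only [Z.coe_sub, hc, hg]
    change _ = _ + _ + ⁅(g b : L), _⁆
    rw [center_lie, add_zero]
    rfl

end LiftingPair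

end Gauge

/-! ### The extension built from a lifting pair with zero obstruction -/

section Twisted

variable {k R B L : Type*} [Field k] [CommRing R]
  [Algebra k R] [LieRing B] [Module R B] [LieRingModule B R] [LieRinehartRing R B]
  [LieAlgebra k B] [LieRinehartAlgebra k R B]
  [LieRing L] [LieAlgebra R L] [Module k L] [IsScalarTower k R L]
  {αbar : LieRinehartAlgebra.Hom (AlgHom.id k R) B (OutD k R L)}

/-- The module `B × L`, carrying the bracket defined by a lifting pair with vanishing
obstruction form. -/
def TwistedProduct (P : LiftingPair αbar) (_ : P.obstruction = 0) : Type _ := B × L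

namespace TwistedProduct

variable {P : LiftingPair αbar} {hP : P.obstruction = 0}

/-- The component in `B`. -/
def fst (x : TwistedProduct P hP) : B := Prod.fst x

/-- The component in `L`. -/
def snd (x : TwistedProduct P hP) : L := Prod.snd x

instance : AddCommGroup (TwistedProduct P hP) := inferInstanceAs (AddCommGroup (B × L))
instance : Module R (TwistedProduct P hP) := inferInstanceAs (Module R (B × L))
instance : Module k (TwistedProduct P hP) := inferInstanceAs (Module k (B × L))
instance : IsScalarTower k R (TwistedProduct P hP) := inferInstanceAs (IsScalarTower k R (B × L))

/-- The bracket `⁅(b, l), (c, m)⁆ = (⁅b, c⁆, α_b m - α_c l + ⁅l, m⁆ + ρ (b, c))`. -/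
instance : Bracket (TwistedProduct P hP) (TwistedProduct P hP) where
  bracket x y := (⁅x.fst, y.fst⁆, P.act x.fst y.snd - P.act y.fst x.snd + ⁅x.snd, y.snd⁆ + P.ρ ![x.fst, y.fst])

lemma ext' {x y : TwistedProduct P hP} (h : x.fst = y.fst) (h' : x.snd = y.snd) : x = y :=
  Prod.ext h h'

@[simp] lemma lie_fst (x y : TwistedProduct P hP) : ⁅x, y⁆.fst = ⁅x.fst, y.fst⁆ := rfl
@[simp] lemma lie_snd (x y : TwistedProduct P hP) : ⁅x, y⁆.snd =
    P.act x.fst y.snd - P.act y.fst x.snd + ⁅x.snd, y.snd⁆ + P.ρ ![x.fst, y.fst] := rfl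
@[simp] lemma add_fst (x y : TwistedProduct P hP) : (x + y).fst = x.fst + y.fst := rfl
@[simp] lemma add_snd (x y : TwistedProduct P hP) : (x + y).snd = x.snd + y.snd := rfl
@[simp] lemma zero_fst : (0 : TwistedProduct P hP).fst = 0 := rfl
@[simp] lemma zero_snd : (0 : TwistedProduct P hP).snd = 0 := rfl
@[simp] lemma smul_fst (r : R) (x : TwistedProduct P hP) : (r • x).fst = r • x.fst := rfl
@[simp] lemma smul_snd (r : R) (x : TwistedProduct P hP) : (r • x).snd = r • x.snd := rfl

instance : LieRing (TwistedProduct P hP) where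
  add_lie x y z := ext' (by simp) (by
    simp only [lie_snd, add_fst, add_snd, map_add, P.act_add, add_lie, form_add_left]; abel)
  lie_add x y z := ext' (by simp) (by
    simp only [lie_snd, add_fst, add_snd, map_add, P.act_add, lie_add, form_add_right]; abel)
  lie_self x := ext' (by simp) (by simp [form_self])
  leibniz_lie x y z := ext' (by simp) (by
    -- This is `d_α ρ = 0` solved for its first term: the component of the Jacobi identity with all
    -- three arguments in `B`.
    have h0 : ∀ a b c, P.act a (P.ρ ![b, c]) = P.act b (P.ρ ![a, c]) - P.act c (P.ρ ![a, b])
        + P.ρ ![⁅a, b⁆, c] - P.ρ ![⁅a, c⁆, b] + P.ρ ![⁅b, c⁆, a] := by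
      intro a b c
      have h : lrDiff P.conn 2 P.ρ ![a, b, c] = 0 := by
        rw [← P.coe_obstruction, hP]; rfl
      rw [P.lrDiff_apply] at h
      rw [← sub_eq_zero, ← h]
      change _ = P.act a (P.ρ ![b, c]) - P.act b (P.ρ ![a, c]) + P.act c (P.ρ ![a, b])
        - P.ρ ![⁅a, b⁆, c] + P.ρ ![⁅a, c⁆, b] - P.ρ ![⁅b, c⁆, a]
      abel
    simp only [lie_snd, add_snd, lie_fst, map_add, map_sub, lie_add, lie_sub, add_lie, sub_lie,
      P.act_lie]
    generalize x.fst = a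
    generalize y.fst = b
    generalize z.fst = c
    generalize x.snd = l
    generalize y.snd = m
    generalize z.snd = n
    rw [h0, P.act_act a b, P.act_act a c, P.act_act b c, form_swap P.ρ a ⁅b, c⁆, form_swap P.ρ b ⁅a, c⁆,
      leibniz_lie l m n, ← lie_skew l (P.ρ ![b, c]), ← lie_skew m (P.ρ ![a, c]),
      ← lie_skew m (P.act c l), ← lie_skew m (P.act a n)]
    abel)

instance : LieRingModule (TwistedProduct P hP) R where
  bracket x r := ⁅x.fst, r⁆
  add_lie x y r := add_lie x.fst y.fst r
  lie_add x r s := lie_add x.fst r s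
  leibniz_lie x y r := leibniz_lie x.fst y.fst r

@[simp] lemma anchor (x : TwistedProduct P hP) (r : R) : ⁅x, r⁆ = ⁅x.fst, r⁆ := rfl

instance : LieRinehartRing R (TwistedProduct P hP) where
  lie_smul_eq_mul' a b x := LieRinehartRing.lie_smul_eq_mul a b x.fst
  leibniz_mul_right' x a b := LieRinehartRing.leibniz_mul_right x.fst a b
  leibniz_smul_right' x y a := ext' (by simp) (by
    simp only [lie_snd, smul_fst, smul_snd, add_snd, P.act_apply_smul, P.act_smul, lie_smul,
      form_smul_right, smul_add, smul_sub, anchor]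
    abel)

instance : LieAlgebra k (TwistedProduct P hP) where
  lie_smul t x y := by
    -- Anchors are `k`-derivations and kill constants, so the Leibniz rule over `R` gives
    -- `k`-bilinearity.
    have h : ⁅x.fst, algebraMap k R t⁆ = 0 :=
      (LieRinehartAlgebra.anchor k R B x.fst).map_algebraMap t
    rw [← algebraMap_smul R t y, LieRinehartRing.leibniz_smul_right, algebraMap_smul, anchor, h,
      zero_smul, add_zero]

instance : LieRinehartAlgebra k R (TwistedProduct P hP) where
  smul_lie t x r := smul_lie t x.fst r
  lie_smul t x r := LieModule.lie_smul t x.fst r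

/-- The inclusion of `B` as an `R`-module. -/
def inl : B →ₗ[R] TwistedProduct P hP := LinearMap.inl R B L

/-- The inclusion of `L`. -/
def inr : L →ₗ[R] TwistedProduct P hP := LinearMap.inr R B L

end TwistedProduct

/-- The extension on `B × L` defined by a lifting pair with vanishing obstruction form. -/
def twistedExtension (P : LiftingPair αbar) (hP : P.obstruction = 0) : Extension k R B L where
  A := TwistedProduct P hP
  lieRinehartRing := inferInstanceAs (LieRinehartRing R (TwistedProduct P hP))
  lieRinehartAlgebra := inferInstanceAs (LieRinehartAlgebra k R (TwistedProduct P hP))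
  incl := TwistedProduct.inr
  incl_lie l m := TwistedProduct.ext' (lie_self (0 : B)).symm (by
    change ⁅l, m⁆ = P.act 0 m - P.act 0 l + ⁅l, m⁆ + P.ρ ![0, 0]
    rw [form_zero_left]
    have h : ∀ l, P.act 0 l = 0 := fun l => by simpa using P.act_smul 0 0 l
    rw [h, h]; abel)
  proj :=
    { toFun := Prod.fst
      map_add' := fun _ _ => rfl
      map_smul' := fun _ _ => rfl
      map_lie' := rfl
      map_smul_apply' := fun _ _ => rfl
      apply_lie' := fun _ _ => rfl }
  incl_injective := LinearMap.inr_injective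
  proj_surjective := Prod.fst_surjective
  exact a := ⟨fun h => ⟨a.snd, TwistedProduct.ext' (Eq.symm h) rfl⟩, fun ⟨_, h⟩ =>
    (congrArg Prod.fst h).symm⟩

lemma twistedExtension_hasLiftingPair (P : LiftingPair αbar) (hP : P.obstruction = 0) :
    (twistedExtension P hP).HasLiftingPair P := by
  refine ⟨TwistedProduct.inl, fun _ => rfl,
    fun b l => TwistedProduct.ext' (P := P) (hP := hP) ?_ ?_,
    fun b c => TwistedProduct.ext' (P := P) (hP := hP) ?_ ?_⟩
  · exact (lie_zero (M := B) b).symm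
  · change P.act b l = P.act b l - P.act 0 0 + ⁅(0 : L), l⁆ + P.ρ ![b, 0]
    rw [form_swap, form_zero_left]
    simp
  · exact (sub_self ⁅b, c⁆).symm
  · change P.ρ ![b, c] = P.act b 0 - P.act c 0 + ⁅(0 : L), (0 : L)⁆ + P.ρ ![b, c] - 0
    simp

end Twisted

/-! ### From split extensions to lifting pairs -/

section Splittings

variable {k R B L : Type*} [Field k] [CommRing R]
  [Algebra k R] [LieRing B] [Module R B] [LieRingModule B R] [LieRinehartRing R B]
  [LieAlgebra k B] [LieRinehartAlgebra k R B]
  [LieRing L] [LieAlgebra R L] [Module k L] [IsScalarTower k R L]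
  {αbar : LieRinehartAlgebra.Hom (AlgHom.id k R) B (OutD k R L)}

/-- The linear map underlying a morphism of Lie-Rinehart algebras. -/
def homLinear {A A' : Type*} [LieRing A] [Module R A] [LieRingModule A R] [LieAlgebra k A]
    [LieRing A'] [Module R A'] [LieRingModule A' R] [LieAlgebra k A']
    (f : LieRinehartAlgebra.Hom (AlgHom.id k R) A A') : A →ₗ[R] A' := f.toLinearMap'

namespace Extension

variable (E : Extension k R B L)

/-- The projection of an extension as a linear map. -/
def projL : E.A →ₗ[R] B := homLinear E.proj

lemma projL_apply (a : E.A) : E.projL a = E.proj a := rfl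

lemma projL_lie (a b : E.A) : E.projL ⁅a, b⁆ = ⁅E.projL a, E.projL b⁆ :=
  E.proj.toLieHom.map_lie a b

lemma projL_anchor (a : E.A) (r : R) : ⁅a, r⁆ = ⁅E.projL a, r⁆ := E.proj.apply_lie r a

lemma projL_incl (l : L) : E.projL (E.incl l) = 0 := (E.exact _).2 ⟨l, rfl⟩

lemma mem_range_incl {a : E.A} (h : E.projL a = 0) : a ∈ LinearMap.range E.incl :=
  (E.exact a).1 h

/-- The splitting `s` of `E` has the lifting pair `P`. -/
structure Describes (P : LiftingPair αbar) (s : B →ₗ[R] E.A) : Prop where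
  proj_split : ∀ b, E.projL (s b) = b
  act_eq : ∀ b l, E.incl (P.act b l) = ⁅s b, E.incl l⁆
  rho_eq : ∀ b c, E.incl (P.ρ ![b, c]) = ⁅s b, s c⁆ - s ⁅b, c⁆

lemma hasLiftingPair_iff (P : LiftingPair αbar) :
    E.HasLiftingPair P ↔ ∃ s, E.Describes P s :=
  ⟨fun ⟨s, h1, h2, h3⟩ => ⟨s, h1, h2, h3⟩, fun ⟨s, h1, h2, h3⟩ => ⟨s, h1, h2, h3⟩⟩

variable {E}

/-- The bracket curvature of a linear splitting. -/
def splitForm (s : B →ₗ[R] E.A) (hs : ∀ b, E.projL (s b) = b) : B [⋀^Fin 2]→ₗ[R] E.A :=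
  twoForm (fun b c => ⁅s b, s c⁆ - s ⁅b, c⁆)
    (fun a a' b => by simp only [map_add, add_lie]; abel)
    (fun r a b => by
      rw [smul_lie_left, map_smul, smul_lie_left, map_sub, map_smul, map_smul, smul_sub,
        projL_anchor, hs]
      abel)
    (fun a b => by rw [← lie_skew, ← lie_skew b a, map_neg]; abel)
    (fun a => by simp)

theorem Induces.exists_hasLiftingPair [Module.Projective R B] (hE : E.Induces αbar) :
    ∃ P : LiftingPair αbar, E.HasLiftingPair P := by
  obtain ⟨s, hs'⟩ := exists_linear_lift E.projL LinearMap.id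
    (fun b => E.proj_surjective b)
  have hs : ∀ b, E.projL (s b) = b := hs'
  choose D hD hD' using fun b => hE (s b)
  have hD1 : ∀ b, outMk (D b) = αbar b := fun b => by
    rw [hD, ← projL_apply, hs]
  obtain ⟨ρ, hρ⟩ := exists_alternating_lift E.incl (splitForm s hs) (fun b => E.mem_range_incl (by
    change E.projL (⁅s (b 0), s (b 1)⁆ - s ⁅b 0, b 1⁆) = 0
    rw [map_sub, projL_lie, hs, hs, hs, sub_self]))
  have hρ' : ∀ b c, E.incl (ρ ![b, c]) = ⁅s b, s c⁆ - s ⁅b, c⁆ := fun b c => hρ ![b, c]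
  -- The pointwise choices `D b` are automatically linear: injectivity of `L → A` fixes the operator
  -- and the coupling fixes the symbol. For scalars, the anchor vanishes on `L`, so the Leibniz
  -- defect of `⁅t • s b, l⁆` disappears.
  let α : B →ₗ[R] derD k R L :=
    { toFun := D
      map_add' := fun b c => derD_ext (fun l => E.incl_injective (by
          change _ = E.incl (derOp (D b) l + derOp (D c) l)
          rw [map_add, hD', hD', hD', map_add, add_lie])) (fun r => by
          change _ = (D b).1.symbol r + (D c).1.symbol r
          rw [symbol_of_lift αbar (hD1 _), symbol_of_lift αbar (hD1 _),
            symbol_of_lift αbar (hD1 _), add_lie])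
      map_smul' := fun t b => derD_ext (fun l => E.incl_injective (by
          change _ = E.incl (t • derOp (D b) l)
          rw [map_smul, hD', hD', map_smul, smul_lie_left, projL_anchor, projL_incl, zero_lie,
            zero_smul, sub_zero])) (fun r => by
          change _ = t * (D b).1.symbol r
          rw [symbol_of_lift αbar (hD1 _), symbol_of_lift αbar (hD1 _),
            LieRinehartRing.lie_smul_eq_mul]) }
  refine ⟨⟨α, ρ, hD1, fun b c => derD_ext (fun l => E.incl_injective ?_) fun r => ?_⟩, s, hs,
    fun b l => hD' b l, hρ'⟩
  · change E.incl (derOp (D b) (derOp (D c) l) - derOp (D c) (derOp (D b) l)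
      - derOp (D ⁅b, c⁆) l) = E.incl ⁅ρ ![b, c], l⁆
    rw [map_sub, map_sub, hD', hD', hD', hD', hD', E.incl_lie, hρ', sub_lie, lie_lie]
  · change ⁅(D b).1.symbol, (D c).1.symbol⁆ r - (D ⁅b, c⁆).1.symbol r = 0
    rw [Derivation.commutator_apply, symbol_of_lift αbar (hD1 _), symbol_of_lift αbar (hD1 _),
      symbol_of_lift αbar (hD1 _), symbol_of_lift αbar (hD1 _), symbol_of_lift αbar (hD1 _),
      lie_lie, sub_self]

namespace Describes

variable {P : LiftingPair αbar} {s : B →ₗ[R] E.A}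

lemma unique {P' : LiftingPair αbar} (h : E.Describes P s) (h' : E.Describes P' s) : P = P' :=
  LiftingPair.ext' (fun b l => E.incl_injective (by rw [h.act_eq, h'.act_eq]))
    (fun b c => E.incl_injective (by rw [h.rho_eq, h'.rho_eq]))

/-- Inside `A` all terms become iterated brackets of values of `s`, and their sum vanishes by the
Jacobi identities of `A` and `B`. -/
lemma obstruction_eq_zero (h : E.Describes P s) : P.obstruction = 0 := by
  refine AlternatingMap.ext fun t => Subtype.ext (E.incl_injective ?_)
  rw [P.coe_obstruction, P.lrDiff_apply]
  change _ = E.incl 0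
  generalize t 0 = a
  generalize t 1 = b
  generalize t 2 = c
  simp only [map_add, map_sub, map_zero, h.act_eq, h.rho_eq, lie_sub]
  rw [LiftingPair.lie_lie_swap a b c, map_sub, ← lie_skew (s c) (s ⁅a, b⁆),
    ← lie_skew (s b) (s ⁅a, c⁆), ← lie_skew (s a) (s ⁅b, c⁆),
    leibniz_lie (s a) (s b) (s c), ← lie_skew (s c) ⁅s a, s b⁆]
  abel

lemma gauge (h : E.Describes P s) (f : B →ₗ[R] L) :
    E.Describes (P.gauge f) (s + E.incl ∘ₗ f) where
  proj_split b := by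
    simp only [LinearMap.add_apply, LinearMap.comp_apply, map_add, h.proj_split, projL_incl,
      add_zero]
  act_eq b l := by
    simp only [LinearMap.add_apply, LinearMap.comp_apply, P.gauge_act, map_add, h.act_eq,
      E.incl_lie, add_lie]
  rho_eq b c := by
    simp only [LinearMap.add_apply, LinearMap.comp_apply, P.gauge_ρ, map_add, map_sub, h.act_eq,
      E.incl_lie, add_lie, lie_add, h.rho_eq]
    rw [← lie_skew (E.incl (f b)) (s c)]
    abel

/-- Two splittings differ by a map into the kernel of the projection, that is, into `L`; a splitting
determines its pair. -/
lemma exists_eq_gauge [Module.Projective R B] {P' : LiftingPair αbar} {s' : B →ₗ[R] E.A}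
    (h : E.Describes P s) (h' : E.Describes P' s') : ∃ f, P' = P.gauge f := by
  obtain ⟨f, hf⟩ := exists_linear_lift E.incl (s' - s) (fun b => E.mem_range_incl (by
    rw [LinearMap.sub_apply, map_sub, h.proj_split, h'.proj_split, sub_self]))
  have hs : s' = s + E.incl ∘ₗ f := LinearMap.ext fun b => by
    rw [LinearMap.add_apply, LinearMap.comp_apply, hf, LinearMap.sub_apply]; abel
  subst hs
  exact ⟨f, h'.unique (h.gauge f)⟩

lemma exists_add (h : E.Describes P s) (a : E.A) : ∃ b l, a = s b + E.incl l := by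
  obtain ⟨l, hl⟩ := E.mem_range_incl (a := a - s (E.projL a)) (by
    rw [map_sub, h.proj_split, sub_self])
  exact ⟨_, l, by rw [hl]; abel⟩

lemma lie_add_add (h : E.Describes P s) (b c : B) (l m : L) :
    ⁅s b + E.incl l, s c + E.incl m⁆ =
      s ⁅b, c⁆ + E.incl (P.ρ ![b, c] + P.act b m - P.act c l + ⁅l, m⁆) := by
  simp only [map_add, map_sub, h.act_eq, h.rho_eq, E.incl_lie, add_lie, lie_add]
  rw [← lie_skew (E.incl l) (s c)]
  abel

lemma induces (h : E.Describes P s) : E.Induces αbar := by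
  intro a
  obtain ⟨b, l, rfl⟩ := h.exists_add a
  refine ⟨P.α b + adD k R L l, ?_, fun m => ?_⟩
  · rw [← projL_apply, map_add, h.proj_split, projL_incl, add_zero, ← P.lift]
    exact (Submodule.Quotient.eq _).2 ⟨l, by simp⟩
  · change E.incl (P.act b m + ⁅l, m⁆) = _
    rw [map_add, h.act_eq, E.incl_lie, add_lie]

/-- The component in `L` of an element of an extension with a splitting. -/
noncomputable def retract (h : E.Describes P s) : E.A →ₗ[R] L :=
  (LinearEquiv.ofInjective E.incl E.incl_injective).symm.toLinearMap ∘ₗ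
    (LinearMap.id - s ∘ₗ E.projL).codRestrict (LinearMap.range E.incl) fun a =>
      E.mem_range_incl (by simp [h.proj_split])

lemma retract_add (h : E.Describes P s) (b : B) (l : L) : h.retract (s b + E.incl l) = l := by
  apply E.incl_injective
  have := LinearEquiv.ofInjective_symm_apply (f := E.incl) (h := E.incl_injective)
    ((LinearMap.id - s ∘ₗ E.projL).codRestrict (LinearMap.range E.incl) (fun a =>
      E.mem_range_incl (by simp [h.proj_split])) (s b + E.incl l))
  refine this.trans ?_
  change s b + E.incl l - s (E.projL (s b + E.incl l)) = _
  rw [map_add E.projL, h.proj_split, projL_incl, add_zero]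
  abel

/-- By `lie_add_add` the pair determines the whole bracket in the coordinates `s b + l`, so `s b + l
↦ s' b + l` is a morphism. -/
lemma equivalent {E' : Extension k R B L} {s' : B →ₗ[R] E'.A} (h : E.Describes P s)
    (h' : E'.Describes P s') : E.Equivalent E' := by
  let φ : E.A →ₗ[R] E'.A := s' ∘ₗ E.projL + E'.incl ∘ₗ h.retract
  have hφ : ∀ b l, φ (s b + E.incl l) = s' b + E'.incl l := fun b l => by
    change s' (E.projL (s b + E.incl l)) + E'.incl (h.retract (s b + E.incl l)) = _
    rw [h.retract_add, map_add E.projL, h.proj_split, projL_incl, add_zero]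
  have hp : ∀ a, E'.projL (φ a) = E.projL a := fun a => by
    change E'.projL (s' (E.projL a) + E'.incl (h.retract a)) = _
    rw [map_add, h'.proj_split, projL_incl, add_zero]
  refine ⟨
    { toFun := φ
      map_add' := map_add φ
      map_smul' := fun t a => ?_
      map_lie' := fun {a a'} => ?_
      map_smul_apply' := fun r a => map_smul φ r a
      apply_lie' := fun r a => ?_ }, fun l => ?_, hp⟩
  · change φ (t • a) = t • φ a
    rw [← algebraMap_smul R t a, map_smul, algebraMap_smul]
  · change φ ⁅a, a'⁆ = ⁅φ a, φ a'⁆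
    obtain ⟨b, l, rfl⟩ := h.exists_add a
    obtain ⟨c, m, rfl⟩ := h.exists_add a'
    rw [h.lie_add_add, hφ, hφ, hφ, h'.lie_add_add]
  · change ⁅a, r⁆ = ⁅φ a, r⁆
    rw [projL_anchor, projL_anchor E', hp]
  · have := hφ 0 l
    rwa [map_zero, map_zero, zero_add, zero_add] at this

end Describes

lemma HasLiftingPair.of_equivalent {P : LiftingPair αbar} {E' : Extension k R B L}
    (h : E.HasLiftingPair P) (e : E.Equivalent E') : E'.HasLiftingPair P := by
  obtain ⟨s, hs⟩ := (E.hasLiftingPair_iff P).1 h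
  obtain ⟨φ, h1, h2⟩ := e
  have hl : ∀ a b, φ ⁅a, b⁆ = ⁅φ a, φ b⁆ := fun a b => φ.toLieHom.map_lie a b
  refine ⟨homLinear φ ∘ₗ s, fun b => (h2 _).trans (hs.proj_split b), fun b l => ?_,
    fun b c => ?_⟩
  · change _ = ⁅φ (s b), _⁆
    rw [← h1, ← h1, ← hl, ← hs.act_eq]
  · change _ = ⁅φ (s b), φ (s c)⁆ - φ (s ⁅b, c⁆)
    rw [← h1, ← hl, hs.rho_eq]
    exact map_sub φ.toLieHom _ _

lemma HasLiftingPair.equivalent {P : LiftingPair αbar} {E' : Extension k R B L}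
    (h : E.HasLiftingPair P) (h' : E'.HasLiftingPair P) : E.Equivalent E' := by
  obtain ⟨s, hs⟩ := (E.hasLiftingPair_iff P).1 h
  obtain ⟨s', hs'⟩ := (E'.hasLiftingPair_iff P).1 h'
  exact hs.equivalent hs'

lemma HasLiftingPair.gauge {P : LiftingPair αbar} (h : E.HasLiftingPair P) (f : B →ₗ[R] L) :
    E.HasLiftingPair (P.gauge f) := by
  obtain ⟨s, hs⟩ := (E.hasLiftingPair_iff P).1 h
  exact (E.hasLiftingPair_iff _).2 ⟨_, hs.gauge f⟩

lemma HasLiftingPair.exists_eq_gauge [Module.Projective R B] {P P' : LiftingPair αbar}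
    (h : E.HasLiftingPair P) (h' : E.HasLiftingPair P') : ∃ f, P' = P.gauge f := by
  obtain ⟨s, hs⟩ := (E.hasLiftingPair_iff P).1 h
  obtain ⟨s', hs'⟩ := (E.hasLiftingPair_iff P').1 h'
  exact hs.exists_eq_gauge hs'

lemma HasLiftingPair.obstruction_eq_zero {P : LiftingPair αbar} (h : E.HasLiftingPair P) :
    P.obstruction = 0 := by
  obtain ⟨s, hs⟩ := (E.hasLiftingPair_iff P).1 h
  exact hs.obstruction_eq_zero

lemma HasLiftingPair.induces {P : LiftingPair αbar} (h : E.HasLiftingPair P) :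
    E.Induces αbar := by
  obtain ⟨s, hs⟩ := (E.hasLiftingPair_iff P).1 h
  exact hs.induces

end Extension

end Splittings

/-! ### The action of `H²` and the obstruction class -/

section Torsor

variable {k R B L : Type*} [Field k] [CommRing R]
  [Algebra k R] [LieRing B] [Module R B] [LieRingModule B R] [LieRinehartRing R B]
  [LieAlgebra k B] [LieRinehartAlgebra k R B] [Module.Projective R B]
  [LieRing L] [LieAlgebra R L] [Module k L] [IsScalarTower k R L]
  {αbar : LieRinehartAlgebra.Hom (AlgHom.id k R) B (OutD k R L)}

lemma LiftingPair.addCentral_addCentral (P : LiftingPair αbar) (γ δ : B [⋀^Fin 2]→ₗ[R] Z R L) :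
    (P.addCentral γ).addCentral δ = P.addCentral (γ + δ) :=
  ext' (fun _ _ => rfl) fun b c => by
    simp only [addCentral_ρ, AlternatingMap.add_apply, Z.coe_add, add_assoc]

lemma LiftingPair.addCentral_zero (P : LiftingPair αbar) : P.addCentral 0 = P :=
  ext' (fun _ _ => rfl) fun b c => by
    simp only [addCentral_ρ, AlternatingMap.zero_apply, Z.coe_zero, add_zero]

lemma LiftingPair.obstruction_addCentral_of_closed {P : LiftingPair αbar}
    (hP : P.obstruction = 0) (γ : cocycles (centerRep αbar) 2) :
    (P.addCentral γ.1).obstruction = 0 :=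
  AlternatingMap.ext fun s => by
    rw [obstruction_addCentral, hP, mem_cocycles_iff.1 γ.2 s]
    exact add_zero _

lemma H.mk_eq_mk_iff {V : LieRinehartAlgebra.Hom (AlgHom.id k R) B (Atiyah k R (Z R L))} {p : ℕ}
    (c d : cocycles V p) : H.mk c = H.mk d ↔ d.1 - c.1 ∈ coboundaries V p := by
  rw [QuotientAddGroup.eq, AddSubgroup.mem_addSubgroupOf, sub_eq_neg_add]
  rfl

lemma ExtClasses.mk_eq_mk_iff (E E' : ExtensionOver αbar) :
    ExtClasses.mk E = ExtClasses.mk E' ↔ E.1.Equivalent E'.1 :=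
  Quotient.eq

namespace ExtensionOver

/-- A lifting pair describing an extension. -/
noncomputable def pair (E : ExtensionOver αbar) : LiftingPair αbar :=
  E.2.exists_hasLiftingPair.choose

lemma hasLiftingPair_pair (E : ExtensionOver αbar) : E.1.HasLiftingPair (pair E) :=
  E.2.exists_hasLiftingPair.choose_spec

lemma exists_of_obstruction_eq_zero {P : LiftingPair αbar} (hP : P.obstruction = 0) :
    ∃ E : ExtensionOver αbar, E.1.HasLiftingPair P :=
  ⟨⟨_, (twistedExtension_hasLiftingPair P hP).induces⟩, twistedExtension_hasLiftingPair P hP⟩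

lemma exists_addCentral {E : ExtensionOver αbar} {P : LiftingPair αbar}
    (h : E.1.HasLiftingPair P) (γ : cocycles (centerRep αbar) 2) :
    ∃ E' : ExtensionOver αbar, E'.1.HasLiftingPair (P.addCentral γ.1) :=
  exists_of_obstruction_eq_zero (LiftingPair.obstruction_addCentral_of_closed
    h.obstruction_eq_zero γ)

/-- The extension described by the lifting pair of `E` translated by a closed central form. -/
noncomputable def translate (γ : cocycles (centerRep αbar) 2) (E : ExtensionOver αbar) :
    ExtensionOver αbar :=
  (exists_addCentral (hasLiftingPair_pair E) γ).choose

lemma translate_spec (γ : cocycles (centerRep αbar) 2) (E : ExtensionOver αbar) :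
    (translate γ E).1.HasLiftingPair ((pair E).addCentral γ.1) :=
  (exists_addCentral (hasLiftingPair_pair E) γ).choose_spec

/-- Well-definedness of the action in all choices at once: the extension, its lifting pair and the
representing cocycle. -/
lemma equivalent_of_addCentral {E₁ E₂ F₁ F₂ : Extension k R B L} {P₁ P₂ : LiftingPair αbar}
    {γ₁ γ₂ : B [⋀^Fin 2]→ₗ[R] Z R L} (e : E₁.Equivalent E₂) (h₁ : E₁.HasLiftingPair P₁)
    (h₂ : E₂.HasLiftingPair P₂) (hγ : γ₁ - γ₂ ∈ coboundaries (centerRep αbar) 2)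
    (h₁' : F₁.HasLiftingPair (P₁.addCentral γ₁)) (h₂' : F₂.HasLiftingPair (P₂.addCentral γ₂)) :
    F₁.Equivalent F₂ := by
  obtain ⟨f, rfl⟩ := (h₁.of_equivalent e).exists_eq_gauge h₂
  -- Adding the exact form `γ₁ - γ₂` is a gauge by `g`. After gauging by `f` and `g`, `F₁` and `F₂`
  -- share the pair `(P₁.gauge f).addCentral γ₁`.
  obtain ⟨g, hg⟩ := ((P₁.gauge f).addCentral γ₂).addCentral_eq_gauge_of_exact hγ
  have h₃ := h₁'.gauge f
  have h₄ := h₂'.gauge g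
  rw [← LiftingPair.gauge_addCentral] at h₃
  rw [← hg, LiftingPair.addCentral_addCentral, add_sub_cancel] at h₄
  exact h₃.equivalent h₄

end ExtensionOver

/-- The action of degree two cohomology on classes of extensions. -/
noncomputable def classVAdd (h : H (centerRep αbar) 2) (x : ExtClasses αbar) : ExtClasses αbar :=
  ExtClasses.mk (ExtensionOver.translate (Quotient.out h) (Quotient.out x))

/-- Frees the action from the representatives chosen in its definition: any pair and any cocycle
compute it. -/
lemma classVAdd_mk {E E' : ExtensionOver αbar} {P : LiftingPair αbar}
    {γ : cocycles (centerRep αbar) 2} (h : E.1.HasLiftingPair P)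
    (h' : E'.1.HasLiftingPair (P.addCentral γ.1)) :
    classVAdd (H.mk γ) (ExtClasses.mk E) = ExtClasses.mk E' := by
  refine (ExtClasses.mk_eq_mk_iff _ _).2 (ExtensionOver.equivalent_of_addCentral
    (E₁ := (Quotient.out (ExtClasses.mk E)).1) (E₂ := E.1) ?_
    (ExtensionOver.hasLiftingPair_pair _) h ?_ (ExtensionOver.translate_spec _ _) h')
  · exact (ExtClasses.mk_eq_mk_iff _ _).1 (Quotient.out_eq _)
  · exact (H.mk_eq_mk_iff _ _).1 (Quotient.out_eq (H.mk γ)).symm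

/-- Transitivity. The central form relating the two pairs is closed because both pairs have zero
obstruction. -/
lemma exists_classVAdd_eq (x y : ExtClasses αbar) : ∃ h, classVAdd h y = x := by
  induction x using Quotient.inductionOn with | _ E' => ?_
  induction y using Quotient.inductionOn with | _ E => ?_
  have hE := ExtensionOver.hasLiftingPair_pair E
  have hE' := ExtensionOver.hasLiftingPair_pair E'
  obtain ⟨f, γ, h⟩ := LiftingPair.exists_eq_gauge_addCentral (ExtensionOver.pair E)
    (ExtensionOver.pair E')
  rw [h] at hE'
  have hγ : γ ∈ cocycles (centerRep αbar) 2 := by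
    rw [mem_cocycles_iff]
    intro s
    have := LiftingPair.obstruction_addCentral ((ExtensionOver.pair E).gauge f) γ s
    rw [hE'.obstruction_eq_zero, (hE.gauge f).obstruction_eq_zero] at this
    exact (zero_add (lrDiff (repConn (centerRep αbar)) 2 γ s)).symm.trans this.symm
  exact ⟨H.mk ⟨γ, hγ⟩, classVAdd_mk (hE.gauge f) hE'⟩

lemma classVAdd_zero (x : ExtClasses αbar) : classVAdd 0 x = x := by
  induction x using Quotient.inductionOn with | _ E => ?_
  refine classVAdd_mk (γ := 0) (ExtensionOver.hasLiftingPair_pair E) ?_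
  change E.1.HasLiftingPair ((ExtensionOver.pair E).addCentral 0)
  rw [LiftingPair.addCentral_zero]
  exact ExtensionOver.hasLiftingPair_pair E

lemma classVAdd_add (g h : H (centerRep αbar) 2) (x : ExtClasses αbar) :
    classVAdd (g + h) x = classVAdd g (classVAdd h x) := by
  induction x using Quotient.inductionOn with | _ E => ?_
  induction g using QuotientAddGroup.induction_on with | _ γ => ?_
  induction h using QuotientAddGroup.induction_on with | _ δ => ?_
  have hE := ExtensionOver.hasLiftingPair_pair E
  obtain ⟨E₁, h₁⟩ := ExtensionOver.exists_addCentral hE δ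
  obtain ⟨E₂, h₂⟩ := ExtensionOver.exists_addCentral h₁ γ
  have e₁ : classVAdd (H.mk δ) (ExtClasses.mk E) = ExtClasses.mk E₁ := classVAdd_mk hE h₁
  have e₂ : classVAdd (H.mk γ) (ExtClasses.mk E₁) = ExtClasses.mk E₂ := classVAdd_mk h₁ h₂
  have e₃ : classVAdd (H.mk (γ + δ)) (ExtClasses.mk E) = ExtClasses.mk E₂ := by
    refine classVAdd_mk hE ?_
    rw [LiftingPair.addCentral_addCentral] at h₂
    change E₂.1.HasLiftingPair ((ExtensionOver.pair E).addCentral (γ.1 + δ.1))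
    rwa [add_comm γ.1]
  exact e₃.trans (by rw [← e₂, ← e₁])

/-- Freeness. If the translate is equivalent to `E`, both `P` and `P.addCentral γ` describe `E`;
they are then gauge equivalent, and `γ` is exact. -/
lemma eq_zero_of_classVAdd_eq {h : H (centerRep αbar) 2} {x : ExtClasses αbar}
    (hx : classVAdd h x = x) : h = 0 := by
  induction x using Quotient.inductionOn with | _ E => ?_
  induction h using QuotientAddGroup.induction_on with | _ γ => ?_
  have hE := ExtensionOver.hasLiftingPair_pair E
  obtain ⟨E₁, h₁⟩ := ExtensionOver.exists_addCentral hE γ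
  have e₁ : classVAdd (H.mk γ) (ExtClasses.mk E) = ExtClasses.mk E₁ := classVAdd_mk hE h₁
  have e := (ExtClasses.mk_eq_mk_iff _ _).1 (e₁.symm.trans hx)
  obtain ⟨f, hf⟩ := hE.exists_eq_gauge (h₁.of_equivalent e)
  have := LiftingPair.exact_of_addCentral_eq_gauge hf
  refine ((H.mk_eq_mk_iff 0 γ).2 ?_).symm
  simpa using this

/-- The classes of extensions as a torsor over degree two cohomology. -/
noncomputable abbrev extTorsor [Nonempty (ExtClasses αbar)] :
    AddTorsor (H (centerRep αbar) 2) (ExtClasses αbar) where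
  vadd := classVAdd
  zero_vadd := classVAdd_zero
  add_vadd := classVAdd_add
  vsub x y := (exists_classVAdd_eq x y).choose
  nonempty := inferInstance
  vsub_vadd' x y := (exists_classVAdd_eq x y).choose_spec
  vadd_vsub' g x := by
    have h := (exists_classVAdd_eq (classVAdd g x) x).choose_spec
    refine sub_eq_zero.1 (eq_zero_of_classVAdd_eq (x := classVAdd g x) ?_)
    rw [← classVAdd_add, sub_add_cancel]
    exact h

/-- The obstruction class of a lifting pair. -/
abbrev LiftingPair.obstructionClass (P : LiftingPair αbar) : H (centerRep αbar) 3 :=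
  H.mk ⟨P.obstruction, P.obstruction_mem_cocycles⟩

lemma LiftingPair.obstructionClass_eq (P P' : LiftingPair αbar) :
    P.obstructionClass = P'.obstructionClass := by
  obtain ⟨f, γ, rfl⟩ := P.exists_eq_gauge_addCentral P'
  rw [H.mk_eq_mk_iff, mem_coboundaries_iff]
  refine ⟨γ, fun s => ?_⟩
  have h := LiftingPair.obstruction_addCentral (P.gauge f) γ s
  rw [P.obstruction_gauge] at h
  rw [AlternatingMap.sub_apply]
  exact (sub_eq_of_eq_add' h).symm

lemma LiftingPair.exists_obstruction_eq_zero {P : LiftingPair αbar}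
    (h : P.obstructionClass = 0) : ∃ P' : LiftingPair αbar, P'.obstruction = 0 := by
  have h' := (H.mk_eq_mk_iff 0 ⟨P.obstruction, P.obstruction_mem_cocycles⟩).1 h.symm
  obtain ⟨γ, hγ⟩ := mem_coboundaries_iff.1 h'
  -- Here `dγ` is the obstruction form, so subtracting its primitive `γ` from `ρ` kills it exactly.
  refine ⟨P.addCentral (-γ), AlternatingMap.ext fun s => ?_⟩
  have hneg : lrDiff (repConn (centerRep αbar)) 2 (-γ) s
      = -lrDiff (repConn (centerRep αbar)) 2 γ s := by
    refine eq_neg_of_add_eq_zero_left ?_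
    rw [← lrDiff_add, neg_add_cancel, lrDiff_two]
    simp
  rw [obstruction_addCentral, hneg, hγ]
  simp

end Torsor

end LRExt

open LRExt

theorem theorem3p2 {k R B L : Type*} [Field k] [CommRing R] [Algebra k R]
    [LieRing B] [Module R B] [LieRingModule B R] [LieRinehartRing R B] [LieAlgebra k B]
    [LieRinehartAlgebra k R B] [Module.Projective R B]
    [LieRing L] [LieAlgebra R L] [Module k L] [IsScalarTower k R L]
    (αbar : LieRinehartAlgebra.Hom (AlgHom.id k R) B (OutD k R L)) :
    Nonempty (LiftingPair αbar) ∧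
    ∃ ob : H (centerRep αbar) 3,
      (∀ P : LiftingPair αbar, ∃ c : cocycles (centerRep αbar) 3,
        (∀ s : Fin 3 → B, ((c.1 s : Z R L) : L) = lrDiff P.conn 2 P.ρ s) ∧ H.mk c = ob) ∧
      (ob = 0 ↔ ∃ E : Extension k R B L, E.Induces αbar) ∧
      (ob = 0 → ∃ T : AddTorsor (H (centerRep αbar) 2) (ExtClasses αbar),
        ∀ E : ExtensionOver αbar,
          (∃ P : LiftingPair αbar, E.1.HasLiftingPair P) ∧
          ∀ P : LiftingPair αbar, E.1.HasLiftingPair P → ∀ γ : cocycles (centerRep αbar) 2,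
            (∃ E' : ExtensionOver αbar, E'.1.HasLiftingPair (P.addCentral γ.1)) ∧
            ∀ E' : ExtensionOver αbar, E'.1.HasLiftingPair (P.addCentral γ.1) →
              T.toAddAction.toVAdd.vadd (H.mk γ) (ExtClasses.mk E) = ExtClasses.mk E') := by
  obtain ⟨P₀⟩ := exists_liftingPair αbar
  have hex : P₀.obstructionClass = 0 → Nonempty (ExtensionOver αbar) := fun h => by
    obtain ⟨P, hP⟩ := LiftingPair.exists_obstruction_eq_zero h
    obtain ⟨E, -⟩ := ExtensionOver.exists_of_obstruction_eq_zero hP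
    exact ⟨E⟩
  refine ⟨⟨P₀⟩, P₀.obstructionClass, fun P => ⟨⟨P.obstruction, P.obstruction_mem_cocycles⟩,
    P.coe_obstruction, P.obstructionClass_eq P₀⟩, ⟨fun h => ?_, fun ⟨E, hE⟩ => ?_⟩, fun h => ?_⟩
  · obtain ⟨E⟩ := hex h
    exact ⟨E.1, E.2⟩
  · obtain ⟨P, hP⟩ := hE.exists_hasLiftingPair
    -- The class may be computed from the pair of the given extension, whose obstruction form is
    -- zero.
    rw [P₀.obstructionClass_eq P]
    refine ((H.mk_eq_mk_iff _ _).2 ?_).symm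
    change P.obstruction - 0 ∈ _
    rw [hP.obstruction_eq_zero, sub_zero]
    exact zero_mem _
  · have : Nonempty (ExtClasses αbar) := (hex h).map ExtClasses.mk
    exact ⟨extTorsor, fun E => ⟨E.2.exists_hasLiftingPair, fun P hP γ =>
      ⟨ExtensionOver.exists_addCentral hP γ, fun E' hE' => classVAdd_mk hP hE'⟩⟩⟩
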